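/- **Setting.** For a permutation $\sigma$ of $[n]=\{1,\dots,n\}$, a point $(i,\sigma(i))$ is a *record* if it is a left-to-right maximum or minimum or a right-to-left maximum or minimum; $\sigma$ is *square* if all its points are records, and $Sq(n)$ is the set of square permutations of size $n$. An *anchored pair of sequences* is $(X,Y,z_0)\in\{U,D\}^n\times\{L,R\}^n\times[n]$; it is *good* if $X_1=X_n=X_{z_0}=D$ and $Y_1=Y_n=L$. For a label $a\in\{U,D\}$ (resp. $a\in\{L,R\}$), let $ct_a(i)$ be the number of labels $a$ among the first $i$ entries of $X$ (resp. $Y$), and let $pos_a(j)$ be the index of the $j$-th label $a$, with $pos_a(0)=0$ and $pos_a(j)=n$ if $j>ct_a(n)$. The label $a$ satisfies the *Petrov conditions* if 1. $|ct_a(i)-ct_a(j)-\frac12(i-j)|<n^{0.4}$ for all $0\le i,j\le n$ with $|i-j|<n^{0.6}$; 2. $|ct_a(i)-ct_a(j)-\frac12(i-j)|<\frac12|i-j|^{0.6}$ for all $0\le i,j\le n$ with $|i-j|>n^{0.3}$; 3. $|pos_a(i)-pos_a(j)-2(i-j)|<n^{0.4}$ for all $0\le i,j\le ct_a(n)$ with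 $|i-j|<n^{0.6}$; 4. $|pos_a(i)-pos_a(j)-2(i-j)|<2|i-j|^{0.6}$ for all $0\le i,j\le ct_a(n)$ with $|i-j|>n^{0.3}$. Let $\Omega_n$ be the set of good anchored pairs $(X,Y,z_0)$ of size $n$ for which all four labels satisfy the Petrov conditions and $n^{0.9}\le z_0\le n-n^{0.9}$ (the *regular* anchored pairs). For an anchored pair put $c=ct_D(z_0)$, $z_2=pos_U(ct_L(n)-c)$, and $$\Lambda_1=\{(pos_D(i),pos_L(c+1-i)) : 1\le i\le c\},$$ $$\Lambda_2=\{(pos_U(i),pos_L(c+i)) : 1\le i\le ct_U(z_2)\},$$ $$\Lambda_3=\{(pos_D(i),pos_R(i-c)) : c<i\le ct_D(n)\},$$ $$\Lambda_4=\{(pos_U(i),pos_R(n-c+1-i)) : ct_U(z_2)<i\le ct_U(n)\}.$$ Let $\rho(X,Y,z_0)$ be the permutation of $[n]$ whose set of points is $\Lambda_1\cup\Lambda_2\cup\Lambda_3\cup\Lambda_4$ (set to an arbitrary permutation if there is none). **Lemma.** For all sufficiently large $n$, for every $(X,Y,z_0)\in\Omega_n$ the set $\Lambda_1\cup\Lambda_2\cup\Lambda_3\cup\Lambda_4$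 is the set of points of the permutation $\rho(X,Y,z_0)$, this permutation is square, and $\rho:\Omega_n\to Sq(n)$ is injective. Moreover, if $\boldsymbol\sigma_n$ is a uniform random square permutation of size $n$, then $$\mathbb P(\boldsymbol\sigma_n\in\rho(\Omega_n))=1-o(1)\qquad\text{as } n\to\infty.$$ -/

import Mathlib

open Filter Topology

namespace SquarePerm

/-! Throughout, `Fin n` stands for `{1, …, n}`: the element `k : Fin n` is the index `k + 1`. -/

section Permutations

variable {n : ℕ}

/-- The point of `σ` in column `i` is a left-to-right maximum. -/
def IsLRMax (σ : Equiv.Perm (Fin n)) (i : Fin n) : Prop := ∀ j, j < i → σ j < σ i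

/-- The point of `σ` in column `i` is a left-to-right minimum. -/
def IsLRMin (σ : Equiv.Perm (Fin n)) (i : Fin n) : Prop := ∀ j, j < i → σ i < σ j

/-- The point of `σ` in column `i` is a right-to-left maximum. -/
def IsRLMax (σ : Equiv.Perm (Fin n)) (i : Fin n) : Prop := ∀ j, i < j → σ j < σ i

/-- The point of `σ` in column `i` is a right-to-left minimum. -/
def IsRLMin (σ : Equiv.Perm (Fin n)) (i : Fin n) : Prop := ∀ j, i < j → σ i < σ j

open Classical in
/-- The square permutations of size `n`: every point is a record. -/
noncomputable def Sq (n : ℕ) : Finset (Equiv.Perm (Fin n)) :=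
  {σ | ∀ i, IsLRMax σ i ∨ IsLRMin σ i ∨ IsRLMax σ i ∨ IsRLMin σ i}

theorem Sq_nonempty (n : ℕ) : (Sq n).Nonempty :=
  ⟨1, by
    simp only [Sq, Finset.mem_filter, Finset.mem_univ, true_and]
    exact fun i => Or.inl fun j hj => hj⟩

/-- The diagram of `σ`, as a set of points of `{1, …, n} × {1, …, n}`. -/
def diagram (σ : Equiv.Perm (Fin n)) : Set (ℕ × ℕ) :=
  Set.range fun k : Fin n => ((k : ℕ) + 1, (σ k : ℕ) + 1)

end Permutations

section Labels

/-- The column labels. -/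
inductive UD
  | U
  | D
  deriving DecidableEq

/-- The row labels. -/
inductive LR
  | L
  | R
  deriving DecidableEq

variable {α : Type} [DecidableEq α] {n : ℕ}

/-- `ct s a i` is the number of labels `a` among the first `i` labels of the sequence `s`. -/
def ct (s : Fin n → α) (a : α) (i : ℕ) : ℕ :=
  (Finset.univ.filter fun k : Fin n => (k : ℕ) + 1 ≤ i ∧ s k = a).card

/-- `pos s a j` is the index (in `{1, …, n}`) of the `j`-th label `a` in the sequence `s`, that is,
the first index up to which there are `j` labels `a`. It is `n` if there are fewer than `j` labels
`a`, and it is `0` for `j = 0`. -/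
def pos (s : Fin n → α) (a : α) (j : ℕ) : ℕ :=
  if h : j ≤ ct s a n then Nat.find (p := fun i => j ≤ ct s a i) ⟨n, h⟩ else n

/-- The Petrov conditions for the label `a` in the sequence `s` of length `n`. -/
structure PetrovLabel (s : Fin n → α) (a : α) : Prop where
  ct_near : ∀ i j : ℕ, i ≤ n → j ≤ n → |(i : ℝ) - j| < (n : ℝ) ^ (3 / 5 : ℝ) →
    |(ct s a i : ℝ) - ct s a j - 1 / 2 * ((i : ℝ) - j)| < (n : ℝ) ^ (2 / 5 : ℝ)
  ct_far : ∀ i j : ℕ, i ≤ n → j ≤ n → (n : ℝ) ^ (3 / 10 : ℝ) < |(i : ℝ) - j| →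
    |(ct s a i : ℝ) - ct s a j - 1 / 2 * ((i : ℝ) - j)| < 1 / 2 * |(i : ℝ) - j| ^ (3 / 5 : ℝ)
  pos_near : ∀ i j : ℕ, i ≤ ct s a n → j ≤ ct s a n → |(i : ℝ) - j| < (n : ℝ) ^ (3 / 5 : ℝ) →
    |(pos s a i : ℝ) - pos s a j - 2 * ((i : ℝ) - j)| < (n : ℝ) ^ (2 / 5 : ℝ)
  pos_far : ∀ i j : ℕ, i ≤ ct s a n → j ≤ ct s a n → (n : ℝ) ^ (3 / 10 : ℝ) < |(i : ℝ) - j| →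
    |(pos s a i : ℝ) - pos s a j - 2 * ((i : ℝ) - j)| < 2 * |(i : ℝ) - j| ^ (3 / 5 : ℝ)

end Labels

/-- An anchored pair of sequences of size `n`. -/
structure Anchored (n : ℕ) where
  X : Fin n → UD
  Y : Fin n → LR
  anchor : Fin n

namespace Anchored

variable {n : ℕ} (ω : Anchored n)

/-- The anchor as a number in `{1, …, n}`. -/
def z₀ : ℕ := (ω.anchor : ℕ) + 1

/-- Good anchored pairs: `X₁ = Xₙ = X_{z₀} = D` and `Y₁ = Yₙ = L`. -/
structure IsGood : Prop where
  X_first : ∀ k : Fin n, (k : ℕ) + 1 = 1 → ω.X k = UD.D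
  X_last : ∀ k : Fin n, (k : ℕ) + 1 = n → ω.X k = UD.D
  X_anchor : ω.X ω.anchor = UD.D
  Y_first : ∀ k : Fin n, (k : ℕ) + 1 = 1 → ω.Y k = LR.L
  Y_last : ∀ k : Fin n, (k : ℕ) + 1 = n → ω.Y k = LR.L

/-- The Petrov conditions for a pair of sequences: they hold for all four labels. -/
structure IsPetrov : Prop where
  U : PetrovLabel ω.X UD.U
  D : PetrovLabel ω.X UD.D
  L : PetrovLabel ω.Y LR.L
  R : PetrovLabel ω.Y LR.R

/-- `z₂ = pos_U (ct_L(n) - ct_D(z₀))`. -/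
def z₂ : ℕ := pos ω.X UD.U (ct ω.Y LR.L n - ct ω.X UD.D ω.z₀)

/-- The points obtained by matching the first `ct_D(z₀)` labels `D` with the first labels `L`. -/
def Λ₁ : Set (ℕ × ℕ) :=
  (fun i => (pos ω.X UD.D i, pos ω.Y LR.L (ct ω.X UD.D ω.z₀ + 1 - i))) ''
    Set.Icc 1 (ct ω.X UD.D ω.z₀)

/-- The points obtained by matching the first labels `U` with the remaining labels `L`. -/
def Λ₂ : Set (ℕ × ℕ) :=
  (fun i => (pos ω.X UD.U i, pos ω.Y LR.L (ct ω.X UD.D ω.z₀ + i))) ''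
    Set.Icc 1 (ct ω.X UD.U ω.z₂)

/-- The points obtained by matching the remaining labels `D` with the first labels `R`. -/
def Λ₃ : Set (ℕ × ℕ) :=
  (fun i => (pos ω.X UD.D i, pos ω.Y LR.R (i - ct ω.X UD.D ω.z₀))) ''
    Set.Icc (ct ω.X UD.D ω.z₀ + 1) (ct ω.X UD.D n)

/-- The points obtained by matching the remaining labels `U` with the remaining labels `R`. -/
def Λ₄ : Set (ℕ × ℕ) :=
  (fun i => (pos ω.X UD.U i, pos ω.Y LR.R (n - ct ω.X UD.D ω.z₀ + 1 - i))) ''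
    Set.Icc (ct ω.X UD.U ω.z₂ + 1) (ct ω.X UD.U n)

/-- All the points of the construction. -/
def points : Set (ℕ × ℕ) := ω.Λ₁ ∪ ω.Λ₂ ∪ ω.Λ₃ ∪ ω.Λ₄

end Anchored

/-- The set `Ω_n` of regular anchored pairs of sequences of size `n`. -/
def Omega (n : ℕ) : Set (Anchored n) :=
  {ω | ω.IsGood ∧ ω.IsPetrov ∧
    (n : ℝ) ^ (9 / 10 : ℝ) ≤ (ω.z₀ : ℝ) ∧ (ω.z₀ : ℝ) ≤ (n : ℝ) - (n : ℝ) ^ (9 / 10 : ℝ)}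

/-- `ρ(X, Y, z₀)` is the permutation whose diagram is `Λ₁ ∪ Λ₂ ∪ Λ₃ ∪ Λ₄`. (It is an arbitrary
permutation where the construction fails, that is, where there is no such permutation.) -/
noncomputable def rho {n : ℕ} (ω : Anchored n) : Equiv.Perm (Fin n) :=
  Classical.epsilon fun σ => diagram σ = ω.points

end SquarePerm

/-! Write `c` for the number of labels `D` up to the anchor. The four families match a column with a
row when the ranks of their labels satisfy one linear equation, which depends on the two labels
(`Matched`). The ranges of ranks used by different families are disjoint, so the matching is
injective both ways for every `c`; as soon as `c ≤ #L ≤ c + #U` it is the graph of a permutation.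

The Petrov conditions force every count `ct s a i` to be `i / 2` up to `n ^ 0.6`, which is
negligible against the distance `n ^ 0.9` of the anchor from both ends. Hence the families lie on
the four sides of a slanted rectangle (`isRectangular_of_mem_Omega`), and each family consists of
records of one kind. Thus the permutation is square. Conversely, its records give back the labels
(`D` for lower records, `L` for left-to-right records) and its lowest point gives back the anchor,
so `rho` is injective (`rho_injOn`).

The probability is a counting statement. Every square permutation is matched to itself by the labels
of its records, with `c` the number of left-to-right minima (`matched_labels`); so `encode` is
injective on `Sq n`. It takes values in the good pairs unless `σ(n) = n`, and these exceptions
number at most `4 ^ n` (`card_Sq_le`). There are at least `n 4 ^ n / 32` good pairs, and by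
Hoeffding's inequality and a union bound only `o(n 4 ^ n)` of them are not regular. Therefore `|Sq
n| ≤ |Ω_n| + o(n 4 ^ n)`, while `|rho '' Ω_n| = |Ω_n|` by injectivity. That `encode` inverts `rho`
is never needed. -/

namespace SquarePerm

/-! ### Ranks and positions of labels. -/

section Labels

variable {α : Type} [DecidableEq α] {n : ℕ} (s : Fin n → α) (a : α)

theorem ct_zero : ct s a 0 = 0 := by simp [ct]

theorem ct_mono : Monotone (ct s a) := fun i j h =>
  Finset.card_le_card fun k hk => by
    simp only [Finset.mem_filter, Finset.mem_univ, true_and] at hk ⊢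
    exact ⟨hk.1.trans h, hk.2⟩

theorem ct_succ_of_eq {k : Fin n} (h : s k = a) : ct s a (k + 1) = ct s a k + 1 := by
  have : (Finset.univ.filter fun j : Fin n => (j : ℕ) + 1 ≤ k + 1 ∧ s j = a)
      = insert k (Finset.univ.filter fun j : Fin n => (j : ℕ) + 1 ≤ k ∧ s j = a) := by
    ext j
    simp only [Finset.mem_filter, Finset.mem_univ, true_and, Finset.mem_insert, Fin.ext_iff]
    constructor
    · rintro ⟨h1, h2⟩
      by_cases hj : (j : ℕ) = k
      · exact Or.inl hj
      · exact Or.inr ⟨by omega, h2⟩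
    · rintro (h1 | ⟨h1, h2⟩)
      · exact ⟨by omega, by rw [Fin.ext h1, h]⟩
      · exact ⟨by omega, h2⟩
  rw [ct, this, Finset.card_insert_of_notMem (by simp)]
  rfl

theorem ct_succ_of_ne {k : Fin n} (h : s k ≠ a) : ct s a (k + 1) = ct s a k := by
  unfold ct
  congr 1
  ext j
  simp only [Finset.mem_filter, Finset.mem_univ, true_and]
  refine ⟨fun ⟨h1, h2⟩ => ⟨?_, h2⟩, fun ⟨h1, h2⟩ => ⟨by omega, h2⟩⟩
  have : (j : ℕ) ≠ k := fun e => h (by rw [← Fin.ext e, h2])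
  omega

theorem ct_add_ct {b : α} (hab : a ≠ b) (h : ∀ k, s k = a ∨ s k = b) {i : ℕ} (hi : i ≤ n) :
    ct s a i + ct s b i = i := by
  induction i with
  | zero => simp [ct_zero]
  | succ i ih =>
    have ih := ih (by omega)
    rcases h ⟨i, hi⟩ with h | h
    · have h1 := ct_succ_of_eq s a h
      have h2 := ct_succ_of_ne s b (h.trans_ne hab)
      simp only at h1 h2
      omega
    · have h1 := ct_succ_of_eq s b h
      have h2 := ct_succ_of_ne s a (h.trans_ne hab.symm)
      simp only at h1 h2
      omega

variable {s a}

theorem ct_lt_ct {i : ℕ} {k : Fin n} (h : s k = a) (hi : i ≤ k) : ct s a i < ct s a (k + 1) := by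
  rw [ct_succ_of_eq s a h]
  exact Nat.lt_succ_of_le (ct_mono s a hi)

theorem ct_pos_of_eq {k : Fin n} (h : s k = a) : 1 ≤ ct s a (k + 1) := by
  rw [ct_succ_of_eq s a h]
  omega

theorem ct_le_ct_length (k : Fin n) : ct s a (k + 1) ≤ ct s a n := ct_mono s a k.2

/-- Ranks order the occurrences of a label as their indices do. -/
theorem ct_lt_ct_iff {k l : Fin n} (hl : s l = a) :
    ct s a (k + 1) < ct s a (l + 1) ↔ k < l := by
  constructor
  · intro h
    by_contra hlk
    exact absurd (ct_mono s a (by simpa using hlk : (l : ℕ) + 1 ≤ k + 1)) (by omega)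
  · exact fun h => ct_lt_ct hl h

theorem ct_le_ct_iff {k l : Fin n} (hk : s k = a) :
    ct s a (k + 1) ≤ ct s a (l + 1) ↔ k ≤ l := by
  rw [← not_lt, ct_lt_ct_iff hk, not_lt]

theorem eq_of_ct_eq {k l : Fin n} (hk : s k = a) (hl : s l = a)
    (h : ct s a (k + 1) = ct s a (l + 1)) : k = l :=
  le_antisymm ((ct_le_ct_iff hk).1 h.le) ((ct_le_ct_iff hl).1 h.ge)

/-- Every rank is attained at the index `pos`. -/
theorem exists_pos_eq {j : ℕ} (h1 : 1 ≤ j) (h2 : j ≤ ct s a n) :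
    ∃ k : Fin n, s k = a ∧ ct s a (k + 1) = j ∧ pos s a j = k + 1 := by
  have hp : pos s a j = Nat.find (p := fun i => j ≤ ct s a i) ⟨n, h2⟩ := by
    rw [pos, dif_pos h2]
  have hs : j ≤ ct s a (pos s a j) := by
    rw [hp]
    exact Nat.find_spec (p := fun i => j ≤ ct s a i) ⟨n, h2⟩
  have hn : pos s a j ≤ n := by
    rw [hp]
    exact Nat.find_min' _ h2
  have hm : ∀ i < pos s a j, ct s a i < j := by
    intro i hi
    rw [hp] at hi
    exact not_le.1 (Nat.find_min (p := fun i => j ≤ ct s a i) ⟨n, h2⟩ hi)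
  obtain ⟨i, hi⟩ : ∃ i, pos s a j = i + 1 := by
    refine Nat.exists_eq_succ_of_ne_zero fun h0 => ?_
    rw [h0, ct_zero] at hs
    omega
  have hlt := hm i (by omega)
  rw [hi] at hs hn
  by_cases h : s ⟨i, hn⟩ = a
  · have := ct_succ_of_eq s a h
    simp only at this
    exact ⟨⟨i, hn⟩, h, by simp only; omega, hi⟩
  · have := ct_succ_of_ne s a h
    simp only at this
    omega

theorem ct_pos {j : ℕ} (h : j ≤ ct s a n) : ct s a (pos s a j) = j := by
  rcases Nat.eq_zero_or_pos j with rfl | h1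
  · have : pos s a 0 = 0 := by simp [pos]
    rw [this, ct_zero]
  · obtain ⟨k, -, h2, h3⟩ := exists_pos_eq h1 h
    rw [h3, h2]

theorem pos_le_length {j : ℕ} : pos s a j ≤ n := by
  rw [pos]
  split_ifs with h
  · exact Nat.find_min' _ h
  · exact le_rfl

theorem pos_eq_iff {j : ℕ} (h1 : 1 ≤ j) (h2 : j ≤ ct s a n) (p : ℕ) :
    p = pos s a j ↔ ∃ k : Fin n, p = k + 1 ∧ s k = a ∧ ct s a (k + 1) = j := by
  obtain ⟨k, hk, hj, hp⟩ := exists_pos_eq h1 h2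
  rw [hp]
  constructor
  · rintro rfl
    exact ⟨k, rfl, hk, hj⟩
  · rintro ⟨l, rfl, hl, hj'⟩
    rw [eq_of_ct_eq hk hl (hj.trans hj'.symm)]

end Labels

theorem ct_U_add_ct_D {n : ℕ} (X : Fin n → UD) {i : ℕ} (hi : i ≤ n) :
    ct X UD.U i + ct X UD.D i = i :=
  ct_add_ct X UD.U (by decide) (fun k => by cases X k <;> simp) hi

theorem ct_L_add_ct_R {n : ℕ} (Y : Fin n → LR) {i : ℕ} (hi : i ≤ n) :
    ct Y LR.L i + ct Y LR.R i = i :=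
  ct_add_ct Y LR.L (by decide) (fun k => by cases Y k <;> simp) hi

end SquarePerm

namespace SquarePerm

/-! ### Matching columns and rows by the ranks of their labels. -/

section Matching

variable {n : ℕ} (X : Fin n → UD) (Y : Fin n → LR) (c : ℕ)

/-- The column `k` and the row `l` are matched: their labels and the ranks of these labels are
related as in the construction of the four families of points. -/
def Matched (k l : Fin n) : Prop :=
  (X k = UD.D ∧ Y l = LR.L ∧ ct X UD.D (k + 1) + ct Y LR.L (l + 1) = c + 1) ∨
  (X k = UD.U ∧ Y l = LR.L ∧ ct Y LR.L (l + 1) = c + ct X UD.U (k + 1)) ∨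
  (X k = UD.D ∧ Y l = LR.R ∧ ct X UD.D (k + 1) = c + ct Y LR.R (l + 1)) ∨
  (X k = UD.U ∧ Y l = LR.R ∧ ct X UD.U (k + 1) + ct Y LR.R (l + 1) + c = n + 1)

variable {X Y c}

/-- The label of the column leaves two families, separated by its rank: a `D` of rank at most `c`
goes to an `L`, a later one to an `R`; a `U` goes to an `L` exactly when its rank plus `c` is at
most `#L`. -/
theorem Matched.right_unique {k l l' : Fin n} (h : Matched X Y c k l) (h' : Matched X Y c k l') :
    l = l' := by
  have h1 := ct_L_add_ct_R Y le_rfl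
  have h2 : ∀ l, Y l = LR.L → 1 ≤ ct Y LR.L (l + 1) := fun l h => ct_pos_of_eq h
  have h3 : ∀ l, Y l = LR.R → 1 ≤ ct Y LR.R (l + 1) := fun l h => ct_pos_of_eq h
  have h4 := fun l => ct_le_ct_length (s := Y) (a := LR.L) l
  have h5 := fun l => ct_le_ct_length (s := Y) (a := LR.R) l
  rcases h with ⟨hX, hY, h⟩ | ⟨hX, hY, h⟩ | ⟨hX, hY, h⟩ | ⟨hX, hY, h⟩ <;>
  rcases h' with ⟨hX', hY', h'⟩ | ⟨hX', hY', h'⟩ | ⟨hX', hY', h'⟩ | ⟨hX', hY', h'⟩ <;>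
  first
  | exact absurd (hX.symm.trans hX') (by decide)
  | exact eq_of_ct_eq hY hY' (by omega)
  | (have := h2 l; have := h2 l'; have := h3 l; have := h3 l'
     have := h4 l; have := h4 l'; have := h5 l; have := h5 l'
     simp only [hY, hY', true_implies] at *; omega)

theorem Matched.left_unique {k k' l : Fin n} (h : Matched X Y c k l) (h' : Matched X Y c k' l) :
    k = k' := by
  have h1 := ct_U_add_ct_D X le_rfl
  have h2 : ∀ l, X l = UD.U → 1 ≤ ct X UD.U (l + 1) := fun l h => ct_pos_of_eq h
  have h3 : ∀ l, X l = UD.D → 1 ≤ ct X UD.D (l + 1) := fun l h => ct_pos_of_eq h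
  have h4 := fun l => ct_le_ct_length (s := X) (a := UD.U) l
  have h5 := fun l => ct_le_ct_length (s := X) (a := UD.D) l
  have h6 : ∀ l, Y l = LR.L → 1 ≤ ct Y LR.L (l + 1) := fun l h => ct_pos_of_eq h
  have h7 : ∀ l, Y l = LR.R → 1 ≤ ct Y LR.R (l + 1) := fun l h => ct_pos_of_eq h
  rcases h with ⟨hX, hY, h⟩ | ⟨hX, hY, h⟩ | ⟨hX, hY, h⟩ | ⟨hX, hY, h⟩ <;>
  rcases h' with ⟨hX', hY', h'⟩ | ⟨hX', hY', h'⟩ | ⟨hX', hY', h'⟩ | ⟨hX', hY', h'⟩ <;>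
  first
  | exact absurd (hY.symm.trans hY') (by decide)
  | exact eq_of_ct_eq hX hX' (by omega)
  | (have := h2 k; have := h2 k'; have := h3 k; have := h3 k'
     have := h4 k; have := h4 k'; have := h5 k; have := h5 k'
     have := h6 l; have := h7 l
     simp only [hX, hX', hY, true_implies] at *; omega)

/-- The three hypotheses say that the rank demanded of the row never exceeds the number of labels
available: `h1` serves the first labels `D`, `h2` the remaining ones, and `h0` keeps the rank
demanded by a late `U` positive. -/
theorem exists_matched (h0 : c ≤ ct X UD.D n) (h1 : c ≤ ct Y LR.L n)
    (h2 : ct Y LR.L n ≤ c + ct X UD.U n) (k : Fin n) :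
    ∃ l, Matched X Y c k l := by
  have h3 := ct_U_add_ct_D X le_rfl
  have h4 := ct_L_add_ct_R Y le_rfl
  cases hX : X k with
  | D =>
    have h5 := ct_pos_of_eq hX
    have h6 := ct_le_ct_length (s := X) (a := UD.D) k
    by_cases hc : ct X UD.D (k + 1) ≤ c
    · obtain ⟨l, hl, hl', -⟩ := exists_pos_eq (s := Y) (a := LR.L)
        (j := c + 1 - ct X UD.D (k + 1)) (by omega) (by omega)
      exact ⟨l, Or.inl ⟨hX, hl, by omega⟩⟩
    · obtain ⟨l, hl, hl', -⟩ := exists_pos_eq (s := Y) (a := LR.R)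
        (j := ct X UD.D (k + 1) - c) (by omega) (by omega)
      exact ⟨l, Or.inr (Or.inr (Or.inl ⟨hX, hl, by omega⟩))⟩
  | U =>
    have h5 := ct_pos_of_eq hX
    have h6 := ct_le_ct_length (s := X) (a := UD.U) k
    by_cases hc : c + ct X UD.U (k + 1) ≤ ct Y LR.L n
    · obtain ⟨l, hl, hl', -⟩ := exists_pos_eq (s := Y) (a := LR.L)
        (j := c + ct X UD.U (k + 1)) (by omega) (by omega)
      exact ⟨l, Or.inr (Or.inl ⟨hX, hl, by omega⟩)⟩
    · obtain ⟨l, hl, hl', -⟩ := exists_pos_eq (s := Y) (a := LR.R)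
        (j := n - c + 1 - ct X UD.U (k + 1)) (by omega) (by omega)
      exact ⟨l, Or.inr (Or.inr (Or.inr ⟨hX, hl, by omega⟩))⟩

/-- A balanced matching is the graph of a permutation. -/
theorem exists_perm_matched (h0 : c ≤ ct X UD.D n) (h1 : c ≤ ct Y LR.L n)
    (h2 : ct Y LR.L n ≤ c + ct X UD.U n) :
    ∃ σ : Equiv.Perm (Fin n), ∀ k, Matched X Y c k (σ k) := by
  choose f hf using exists_matched h0 h1 h2
  have hinj : Function.Injective f := fun k k' h => (hf k).left_unique (by rw [h]; exact hf k')
  exact ⟨Equiv.ofBijective f (Finite.injective_iff_bijective.1 hinj), hf⟩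

end Matching

theorem diagram_injective {n : ℕ} : Function.Injective (diagram (n := n)) := by
  intro σ τ h
  ext k
  have : ((k : ℕ) + 1, (σ k : ℕ) + 1) ∈ diagram τ := h ▸ ⟨k, rfl⟩
  obtain ⟨l, hl⟩ := this
  simp only [Prod.mk.injEq, Nat.add_right_cancel_iff] at hl
  obtain rfl := Fin.ext hl.1
  exact hl.2.symm

/-! ### The four families of points as a matching. -/

namespace Anchored

variable {n : ℕ} (ω : Anchored n)

/-- The number of labels `D` up to the anchor. -/
def anchorRank : ℕ := ct ω.X UD.D ω.z₀

/-- The columns and rows of an anchored pair matched by the construction. -/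
def Rel (k l : Fin n) : Prop := Matched ω.X ω.Y ω.anchorRank k l

/-- The numbers of labels allow the construction of a permutation. -/
structure IsBalanced : Prop where
  rank_le : ω.anchorRank ≤ ct ω.Y LR.L n
  le_rank_add : ct ω.Y LR.L n ≤ ω.anchorRank + ct ω.X UD.U n

variable {ω}

theorem anchorRank_le : ω.anchorRank ≤ ct ω.X UD.D n := ct_mono _ _ ω.anchor.2

theorem ct_z₀ : ct ω.X UD.D ω.z₀ = ω.anchorRank := rfl

theorem ct_z₂ (h : ω.IsBalanced) : ct ω.X UD.U ω.z₂ = ct ω.Y LR.L n - ω.anchorRank := by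
  rw [z₂, ct_z₀]
  have := h.le_rank_add
  exact ct_pos (by omega)

theorem mem_Λ₁ (h : ω.IsBalanced) (p v : ℕ) : (p, v) ∈ ω.Λ₁ ↔ ∃ k l : Fin n, p = k + 1 ∧
    v = l + 1 ∧ ω.X k = UD.D ∧ ω.Y l = LR.L ∧
    ct ω.X UD.D (k + 1) + ct ω.Y LR.L (l + 1) = ω.anchorRank + 1 := by
  have h1 := h.rank_le
  have h2 := ω.anchorRank_le
  simp only [Λ₁, Set.mem_image, Set.mem_Icc, Prod.mk.injEq, ct_z₀]
  constructor
  · rintro ⟨i, ⟨hi1, hi2⟩, rfl, rfl⟩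
    obtain ⟨k, hk, hk', hp⟩ := exists_pos_eq (s := ω.X) (a := UD.D) hi1 (by omega)
    obtain ⟨l, hl, hl', hv⟩ := exists_pos_eq (s := ω.Y) (a := LR.L)
      (j := ω.anchorRank + 1 - i) (by omega) (by omega)
    exact ⟨k, l, hp, hv, hk, hl, by omega⟩
  · rintro ⟨k, l, rfl, rfl, hk, hl, e⟩
    have h3 := ct_pos_of_eq hk
    have h4 := ct_pos_of_eq hl
    exact ⟨ct ω.X UD.D (k + 1), ⟨h3, by omega⟩,
      ((pos_eq_iff h3 (ct_le_ct_length k) _).2 ⟨k, rfl, hk, rfl⟩).symm,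
      ((pos_eq_iff (by omega) (by omega) _).2 ⟨l, rfl, hl, by omega⟩).symm⟩

theorem mem_Λ₂ (h : ω.IsBalanced) (p v : ℕ) : (p, v) ∈ ω.Λ₂ ↔ ∃ k l : Fin n, p = k + 1 ∧
    v = l + 1 ∧ ω.X k = UD.U ∧ ω.Y l = LR.L ∧
    ct ω.Y LR.L (l + 1) = ω.anchorRank + ct ω.X UD.U (k + 1) := by
  have h1 := h.rank_le
  have h2 := h.le_rank_add
  simp only [Λ₂, Set.mem_image, Set.mem_Icc, Prod.mk.injEq, ct_z₀, ct_z₂ h]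
  constructor
  · rintro ⟨i, ⟨hi1, hi2⟩, rfl, rfl⟩
    obtain ⟨k, hk, hk', hp⟩ := exists_pos_eq (s := ω.X) (a := UD.U) hi1 (by omega)
    obtain ⟨l, hl, hl', hv⟩ := exists_pos_eq (s := ω.Y) (a := LR.L)
      (j := ω.anchorRank + i) (by omega) (by omega)
    exact ⟨k, l, hp, hv, hk, hl, by omega⟩
  · rintro ⟨k, l, rfl, rfl, hk, hl, e⟩
    have h3 := ct_pos_of_eq hk
    have h4 := ct_le_ct_length (s := ω.Y) (a := LR.L) l
    exact ⟨ct ω.X UD.U (k + 1), ⟨h3, by omega⟩,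
      ((pos_eq_iff h3 (ct_le_ct_length k) _).2 ⟨k, rfl, hk, rfl⟩).symm,
      ((pos_eq_iff (by omega) (by omega) _).2 ⟨l, rfl, hl, by omega⟩).symm⟩

theorem mem_Λ₃ (h : ω.IsBalanced) (p v : ℕ) : (p, v) ∈ ω.Λ₃ ↔ ∃ k l : Fin n, p = k + 1 ∧
    v = l + 1 ∧ ω.X k = UD.D ∧ ω.Y l = LR.R ∧
    ct ω.X UD.D (k + 1) = ω.anchorRank + ct ω.Y LR.R (l + 1) := by
  have h1 := h.rank_le
  have h2 := h.le_rank_add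
  have h5 := ct_U_add_ct_D ω.X le_rfl
  have h6 := ct_L_add_ct_R ω.Y le_rfl
  simp only [Λ₃, Set.mem_image, Set.mem_Icc, Prod.mk.injEq, ct_z₀]
  constructor
  · rintro ⟨i, ⟨hi1, hi2⟩, rfl, rfl⟩
    obtain ⟨k, hk, hk', hp⟩ := exists_pos_eq (s := ω.X) (a := UD.D) (j := i) (by omega) hi2
    obtain ⟨l, hl, hl', hv⟩ := exists_pos_eq (s := ω.Y) (a := LR.R)
      (j := i - ω.anchorRank) (by omega) (by omega)
    exact ⟨k, l, hp, hv, hk, hl, by omega⟩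
  · rintro ⟨k, l, rfl, rfl, hk, hl, e⟩
    have h3 := ct_pos_of_eq hk
    have h4 := ct_pos_of_eq hl
    have h7 := ct_le_ct_length (s := ω.X) (a := UD.D) k
    exact ⟨ct ω.X UD.D (k + 1), ⟨by omega, h7⟩,
      ((pos_eq_iff h3 h7 _).2 ⟨k, rfl, hk, rfl⟩).symm,
      ((pos_eq_iff (by omega) (by omega) _).2 ⟨l, rfl, hl, by omega⟩).symm⟩

theorem mem_Λ₄ (h : ω.IsBalanced) (p v : ℕ) : (p, v) ∈ ω.Λ₄ ↔ ∃ k l : Fin n, p = k + 1 ∧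
    v = l + 1 ∧ ω.X k = UD.U ∧ ω.Y l = LR.R ∧
    ct ω.X UD.U (k + 1) + ct ω.Y LR.R (l + 1) + ω.anchorRank = n + 1 := by
  have h1 := h.rank_le
  have h2 := h.le_rank_add
  have h5 := ct_U_add_ct_D ω.X le_rfl
  have h6 := ct_L_add_ct_R ω.Y le_rfl
  have h8 := ω.anchorRank_le
  simp only [Λ₄, Set.mem_image, Set.mem_Icc, Prod.mk.injEq, ct_z₀, ct_z₂ h]
  constructor
  · rintro ⟨i, ⟨hi1, hi2⟩, rfl, rfl⟩
    obtain ⟨k, hk, hk', hp⟩ := exists_pos_eq (s := ω.X) (a := UD.U) (j := i) (by omega) hi2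
    obtain ⟨l, hl, hl', hv⟩ := exists_pos_eq (s := ω.Y) (a := LR.R)
      (j := n - ω.anchorRank + 1 - i) (by omega) (by omega)
    exact ⟨k, l, hp, hv, hk, hl, by omega⟩
  · rintro ⟨k, l, rfl, rfl, hk, hl, e⟩
    have h3 := ct_pos_of_eq hk
    have h4 := ct_le_ct_length (s := ω.Y) (a := LR.R) l
    have h7 := ct_le_ct_length (s := ω.X) (a := UD.U) k
    have h9 := ct_pos_of_eq hl
    exact ⟨ct ω.X UD.U (k + 1), ⟨by omega, h7⟩,
      ((pos_eq_iff h3 h7 _).2 ⟨k, rfl, hk, rfl⟩).symm,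
      ((pos_eq_iff (by omega) (by omega) _).2 ⟨l, rfl, hl, by omega⟩).symm⟩

theorem mem_points (h : ω.IsBalanced) (p v : ℕ) :
    (p, v) ∈ ω.points ↔ ∃ k l : Fin n, p = k + 1 ∧ v = l + 1 ∧ ω.Rel k l := by
  simp only [points, Set.mem_union, mem_Λ₁ h, mem_Λ₂ h, mem_Λ₃ h, mem_Λ₄ h, Rel, Matched]
  constructor
  · rintro (((⟨k, l, h1, h2, h⟩ | ⟨k, l, h1, h2, h⟩) | ⟨k, l, h1, h2, h⟩) | ⟨k, l, h1, h2, h⟩)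
    · exact ⟨k, l, h1, h2, Or.inl h⟩
    · exact ⟨k, l, h1, h2, Or.inr (Or.inl h)⟩
    · exact ⟨k, l, h1, h2, Or.inr (Or.inr (Or.inl h))⟩
    · exact ⟨k, l, h1, h2, Or.inr (Or.inr (Or.inr h))⟩
  · rintro ⟨k, l, h1, h2, h | h | h | h⟩
    · exact Or.inl (Or.inl (Or.inl ⟨k, l, h1, h2, h⟩))
    · exact Or.inl (Or.inl (Or.inr ⟨k, l, h1, h2, h⟩))
    · exact Or.inl (Or.inr ⟨k, l, h1, h2, h⟩)
    · exact Or.inr ⟨k, l, h1, h2, h⟩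

theorem diagram_eq_points (h : ω.IsBalanced) {σ : Equiv.Perm (Fin n)} (hσ : ∀ k, ω.Rel k (σ k)) :
    diagram σ = ω.points := by
  ext ⟨p, v⟩
  rw [mem_points h]
  simp only [diagram, Set.mem_range, Prod.mk.injEq]
  constructor
  · rintro ⟨k, rfl, rfl⟩
    exact ⟨k, σ k, rfl, rfl, hσ k⟩
  · rintro ⟨k, l, rfl, rfl, hkl⟩
    exact ⟨k, rfl, by rw [(hσ k).right_unique hkl]⟩

theorem diagram_rho (h : ω.IsBalanced) : diagram (rho ω) = ω.points := by
  obtain ⟨σ, hσ⟩ := exists_perm_matched ω.anchorRank_le h.rank_le h.le_rank_add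
  exact Classical.epsilon_spec (p := fun σ => diagram σ = ω.points) ⟨σ, diagram_eq_points h hσ⟩

theorem rel_rho (h : ω.IsBalanced) (k : Fin n) : ω.Rel k (rho ω k) := by
  obtain ⟨σ, hσ⟩ := exists_perm_matched ω.anchorRank_le h.rank_le h.le_rank_add
  have : rho ω = σ := diagram_injective ((diagram_rho h).trans (diagram_eq_points h hσ).symm)
  rw [this]
  exact hσ k

end Anchored
end SquarePerm

namespace SquarePerm

/-! ### Position of records relative to the diagonals. -/

section Records

variable {n : ℕ} {σ : Equiv.Perm (Fin n)} {k : Fin n}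

theorem mem_Sq : σ ∈ Sq n ↔ ∀ i, IsLRMax σ i ∨ IsLRMin σ i ∨ IsRLMax σ i ∨ IsRLMin σ i := by
  simp [Sq]

theorem card_filter_apply (p : Fin n → Prop) [DecidablePred p] :
    (Finset.univ.filter fun j => p (σ j)).card = (Finset.univ.filter p).card :=
  Finset.card_bij' (fun j _ => σ j) (fun j _ => σ.symm j) (by simp) (by simp) (by simp) (by simp)

/-- The `σ k` smaller values all occur to the left of column `k`, where there are only `k` columns.
The next two lemmas are the same pigeonhole argument. -/
theorem IsRLMin.apply_le (h : IsRLMin σ k) : σ k ≤ k := by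
  have h1 := card_filter_apply (σ := σ) (fun j => j < σ k)
  have h2 : (Finset.univ.filter fun j => σ j < σ k).card
      ≤ (Finset.univ.filter fun j => j < k).card := by
    refine Finset.card_le_card fun j hj => ?_
    simp only [Finset.mem_filter, Finset.mem_univ, true_and] at hj ⊢
    by_contra hjk
    rcases (not_lt.1 hjk).eq_or_lt with rfl | hlt
    · exact lt_irrefl _ hj
    · exact lt_asymm hj (h j hlt)
  simp only [Finset.filter_gt_eq_Iio, Fin.card_Iio] at h1 h2
  rw [Fin.le_def]
  omega

theorem IsLRMax.le_apply (h : IsLRMax σ k) : k ≤ σ k := by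
  have h1 := card_filter_apply (σ := σ) (fun j => j < σ k)
  have h2 : (Finset.univ.filter fun j => j < k).card
      ≤ (Finset.univ.filter fun j => σ j < σ k).card := by
    refine Finset.card_le_card fun j hj => ?_
    simp only [Finset.mem_filter, Finset.mem_univ, true_and] at hj ⊢
    exact h j hj
  simp only [Finset.filter_gt_eq_Iio, Fin.card_Iio] at h1 h2
  rw [Fin.le_def]
  omega

theorem IsLRMin.add_apply_lt (h : IsLRMin σ k) : (k : ℕ) + σ k < n := by
  have h1 := card_filter_apply (σ := σ) (fun j => σ k < j)
  have h2 : (Finset.univ.filter fun j => j < k).card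
      ≤ (Finset.univ.filter fun j => σ k < σ j).card := by
    refine Finset.card_le_card fun j hj => ?_
    simp only [Finset.mem_filter, Finset.mem_univ, true_and] at hj ⊢
    exact h j hj
  simp only [Finset.filter_gt_eq_Iio, Finset.filter_lt_eq_Ioi, Fin.card_Iio, Fin.card_Ioi] at h1 h2
  have := (σ k).2
  omega

end Records

/-! ### Squareness and recovery of the anchored pair from the rectangular shape. -/

namespace Anchored

variable {n : ℕ} {ω : Anchored n}

/-- The four families of points of the construction lie on the four sides of a slanted rectangle. -/
structure IsRectangular (ω : Anchored n) : Prop where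
  good : ω.IsGood
  -- Strictness of this inequality and the next puts row `n` in the second family and column `n` in
  -- the third, which is what makes the labels readable from the permutation.
  rank_lt_L : ω.anchorRank < ct ω.Y LR.L n
  rank_lt_D : ω.anchorRank < ct ω.X UD.D n
  le_rank_add : ct ω.Y LR.L n ≤ ω.anchorRank + ct ω.X UD.U n
  side_DL : ∀ k l : Fin n, ω.X k = UD.D → ω.Y l = LR.L →
    ct ω.X UD.D (k + 1) + ct ω.Y LR.L (l + 1) = ω.anchorRank + 1 → (k : ℕ) + l < n
  side_UL : ∀ k l : Fin n, ω.X k = UD.U → ω.Y l = LR.L →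
    ct ω.Y LR.L (l + 1) = ω.anchorRank + ct ω.X UD.U (k + 1) → k < l
  side_DR : ∀ k l : Fin n, ω.X k = UD.D → ω.Y l = LR.R →
    ct ω.X UD.D (k + 1) = ω.anchorRank + ct ω.Y LR.R (l + 1) → l < k
  side_UR : ∀ k l : Fin n, ω.X k = UD.U → ω.Y l = LR.R →
    ct ω.X UD.U (k + 1) + ct ω.Y LR.R (l + 1) + ω.anchorRank = n + 1 → n ≤ (k : ℕ) + l

namespace IsRectangular

theorem isBalanced (h : ω.IsRectangular) : ω.IsBalanced := ⟨h.rank_lt_L.le, h.le_rank_add⟩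

variable {σ : Equiv.Perm (Fin n)} {k : Fin n}

/-- Within the same family and against the two adjacent sides, comparing ranks suffices. Only the
opposite side needs geometry: one of the two diagonals separates it from this one. The other three
kinds of record are handled in the same way. -/
theorem isLRMin_of_DL (h : ω.IsRectangular) (hσ : ∀ k, ω.Rel k (σ k)) (hX : ω.X k = UD.D)
    (hY : ω.Y (σ k) = LR.L) : IsLRMin σ k := by
  intro j hj
  have hk : ct ω.X UD.D (k + 1) + ct ω.Y LR.L (σ k + 1) = ω.anchorRank + 1 := by
    have h1 := ct_pos_of_eq hX
    have h2 := ct_pos_of_eq hY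
    rcases hσ k with ⟨h3, h4, e⟩ | ⟨h3, h4, e⟩ | ⟨h3, h4, e⟩ | ⟨h3, h4, e⟩
    · exact e
    all_goals simp_all
  rcases hσ j with ⟨h3, h4, e⟩ | ⟨h3, h4, e⟩ | ⟨h3, h4, e⟩ | ⟨h3, h4, e⟩
  · rw [← ct_lt_ct_iff h4]
    have := (ct_lt_ct_iff hX).2 hj
    omega
  · rw [← ct_lt_ct_iff h4]
    have := ct_pos_of_eq h3
    have := ct_pos_of_eq hX
    omega
  · have := (ct_lt_ct_iff hX).2 hj
    have := ct_pos_of_eq hY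
    omega
  · have h5 := h.side_UR _ _ h3 h4 e
    have h6 := h.side_DL _ _ hX hY hk
    rw [Fin.lt_def] at hj ⊢
    omega

theorem isLRMax_of_UL (h : ω.IsRectangular) (hσ : ∀ k, ω.Rel k (σ k)) (hX : ω.X k = UD.U)
    (hY : ω.Y (σ k) = LR.L) : IsLRMax σ k := by
  intro j hj
  have hk : ct ω.Y LR.L (σ k + 1) = ω.anchorRank + ct ω.X UD.U (k + 1) := by
    rcases hσ k with ⟨h3, h4, e⟩ | ⟨h3, h4, e⟩ | ⟨h3, h4, e⟩ | ⟨h3, h4, e⟩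
    all_goals simp_all
  have h1 := ct_pos_of_eq hX
  rcases hσ j with ⟨h3, h4, e⟩ | ⟨h3, h4, e⟩ | ⟨h3, h4, e⟩ | ⟨h3, h4, e⟩
  · rw [← ct_lt_ct_iff hY]
    have := ct_pos_of_eq h3
    omega
  · rw [← ct_lt_ct_iff hY]
    have := (ct_lt_ct_iff hX).2 hj
    omega
  · exact (h.side_DR _ _ h3 h4 e).trans (hj.trans (h.side_UL _ _ hX hY hk))
  · have := (ct_lt_ct_iff hX).2 hj
    have := ct_le_ct_length (s := ω.Y) (a := LR.L) (σ k)
    have := ct_le_ct_length (s := ω.Y) (a := LR.R) (σ j)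
    have := ct_L_add_ct_R ω.Y le_rfl
    omega

theorem isRLMin_of_DR (h : ω.IsRectangular) (hσ : ∀ k, ω.Rel k (σ k)) (hX : ω.X k = UD.D)
    (hY : ω.Y (σ k) = LR.R) : IsRLMin σ k := by
  intro j hj
  have hk : ct ω.X UD.D (k + 1) = ω.anchorRank + ct ω.Y LR.R (σ k + 1) := by
    rcases hσ k with ⟨h3, h4, e⟩ | ⟨h3, h4, e⟩ | ⟨h3, h4, e⟩ | ⟨h3, h4, e⟩
    all_goals simp_all
  have h1 := ct_pos_of_eq hY
  rcases hσ j with ⟨h3, h4, e⟩ | ⟨h3, h4, e⟩ | ⟨h3, h4, e⟩ | ⟨h3, h4, e⟩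
  · have := (ct_lt_ct_iff h3).2 hj
    have := ct_pos_of_eq h4
    omega
  · exact (h.side_DR _ _ hX hY hk).trans (hj.trans (h.side_UL _ _ h3 h4 e))
  · rw [← ct_lt_ct_iff h4]
    have := (ct_lt_ct_iff h3).2 hj
    omega
  · rw [← ct_lt_ct_iff h4]
    have := ct_le_ct_length (s := ω.X) (a := UD.D) k
    have := ct_le_ct_length (s := ω.X) (a := UD.U) j
    have := ct_U_add_ct_D ω.X le_rfl
    omega

theorem isRLMax_of_UR (h : ω.IsRectangular) (hσ : ∀ k, ω.Rel k (σ k)) (hX : ω.X k = UD.U)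
    (hY : ω.Y (σ k) = LR.R) : IsRLMax σ k := by
  intro j hj
  have hk : ct ω.X UD.U (k + 1) + ct ω.Y LR.R (σ k + 1) + ω.anchorRank = n + 1 := by
    rcases hσ k with ⟨h3, h4, e⟩ | ⟨h3, h4, e⟩ | ⟨h3, h4, e⟩ | ⟨h3, h4, e⟩
    all_goals simp_all
  rcases hσ j with ⟨h3, h4, e⟩ | ⟨h3, h4, e⟩ | ⟨h3, h4, e⟩ | ⟨h3, h4, e⟩
  · have h5 := h.side_UR _ _ hX hY hk
    have h6 := h.side_DL _ _ h3 h4 e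
    rw [Fin.lt_def] at hj ⊢
    omega
  · have := (ct_lt_ct_iff h3).2 hj
    have := ct_le_ct_length (s := ω.Y) (a := LR.L) (σ j)
    have := ct_le_ct_length (s := ω.Y) (a := LR.R) (σ k)
    have := ct_L_add_ct_R ω.Y le_rfl
    omega
  · rw [← ct_lt_ct_iff hY]
    have := ct_le_ct_length (s := ω.X) (a := UD.D) j
    have := ct_le_ct_length (s := ω.X) (a := UD.U) k
    have := ct_U_add_ct_D ω.X le_rfl
    omega
  · rw [← ct_lt_ct_iff hY]
    have := (ct_lt_ct_iff h3).2 hj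
    omega

theorem mem_Sq (h : ω.IsRectangular) (hσ : ∀ k, ω.Rel k (σ k)) : σ ∈ Sq n := by
  rw [SquarePerm.mem_Sq]
  intro k
  cases hX : ω.X k <;> cases hY : ω.Y (σ k)
  · exact Or.inl (h.isLRMax_of_UL hσ hX hY)
  · exact Or.inr (Or.inr (Or.inl (h.isRLMax_of_UR hσ hX hY)))
  · exact Or.inr (Or.inl (h.isLRMin_of_DL hσ hX hY))
  · exact Or.inr (Or.inr (Or.inr (h.isRLMin_of_DR hσ hX hY)))

theorem apply_anchor (h : ω.IsRectangular) (hσ : ∀ k, ω.Rel k (σ k)) :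
    (σ ω.anchor : ℕ) = 0 := by
  have h0 : ct ω.X UD.D (ω.anchor + 1) = ω.anchorRank := rfl
  have hX := h.good.X_anchor
  have hpos : 0 < n := (Nat.zero_le _).trans_lt ω.anchor.2
  have hY0 := h.good.Y_first ⟨0, hpos⟩ rfl
  have h1 := ct_succ_of_eq _ _ hY0
  simp only [ct_zero] at h1
  rcases hσ ω.anchor with ⟨h3, h4, e⟩ | ⟨h3, h4, e⟩ | ⟨h3, h4, e⟩ | ⟨h3, h4, e⟩
  -- The anchor is the `D` of rank `c`, so its row is the `L` of rank one; this is the lowest row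
  -- because `Y₁ = L`.
  · have := eq_of_ct_eq h4 hY0 (by simp only; omega)
    rw [this]
  · simp_all
  · have := ct_pos_of_eq h4
    omega
  · simp_all

/-- The labels `D` mark the columns of the lower records. -/
theorem X_eq_D_iff (h : ω.IsRectangular) (hσ : ∀ k, ω.Rel k (σ k)) (k : Fin n) :
    ω.X k = UD.D ↔ IsLRMin σ k ∨ IsRLMin σ k := by
  have hpos : 0 < n := (Nat.zero_le _).trans_lt ω.anchor.2
  constructor
  · intro hX
    cases hY : ω.Y (σ k)
    · exact Or.inl (h.isLRMin_of_DL hσ hX hY)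
    · exact Or.inr (h.isRLMin_of_DR hσ hX hY)
  · intro hmin
    by_contra hD
    rcases hσ k with ⟨h3, h4, e⟩ | ⟨h3, h4, e⟩ | ⟨h3, h4, e⟩ | ⟨h3, h4, e⟩
    · exact hD h3
    · rcases hmin with hm | hm
      -- The first column has label `D` and rank one, so its row is the `L` of rank `c`, below every
      -- row of the `U`–`L` family.
      · have hX0 := h.good.X_first ⟨0, hpos⟩ rfl
        have hk0 : (⟨0, hpos⟩ : Fin n) < k := by
          rw [Fin.lt_def, Nat.pos_iff_ne_zero]
          intro hk
          rw [show k = ⟨0, hpos⟩ from Fin.ext hk] at hD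
          exact hD hX0
        have hlt := hm _ hk0
        have h1 := ct_succ_of_eq _ _ hX0
        simp only [ct_zero] at h1
        have h2 := ct_pos_of_eq h3
        have h6 := ct_pos_of_eq h.good.X_anchor
        have h7 : ct ω.X UD.D (ω.anchor + 1) = ω.anchorRank := rfl
        have h8 := hσ ⟨0, hpos⟩
        rcases h8 with ⟨h3', h4', e'⟩ | ⟨h3', h4', e'⟩ | ⟨h3', h4', e'⟩ | ⟨h3', h4', e'⟩
        · rw [← ct_lt_ct_iff h4'] at hlt
          simp only at e'
          omega
        · simp_all
        · have := ct_pos_of_eq h4'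
          simp only at e'
          omega
        · simp_all
      · exact absurd hm.apply_le (not_le.2 (h.side_UL _ _ h3 h4 e))
    · exact hD h3
    · rcases hmin with hm | hm
      · exact absurd hm.add_apply_lt (not_lt.2 (h.side_UR _ _ h3 h4 e))
      -- The last column is a `D` of rank greater than `c`, so it lies in the `D`–`R` family, whose
      -- rows precede those of the `U`–`R` family among the labels `R`.
      · have hXl := h.good.X_last ⟨n - 1, by omega⟩ (by simp only; omega)
        have hkl : k < ⟨n - 1, by omega⟩ := by
          rw [Fin.lt_def]
          have : (k : ℕ) ≠ n - 1 := by
            intro hk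
            rw [show k = ⟨n - 1, by omega⟩ from Fin.ext hk] at hD
            exact hD hXl
          simp only
          omega
        have hlt := hm _ hkl
        have h1 := h.rank_lt_D
        have h5 := ct_U_add_ct_D ω.X le_rfl
        have h6 := ct_le_ct_length (s := ω.X) (a := UD.U) k
        have h7 : n - 1 + 1 = n := by omega
        rcases hσ ⟨n - 1, by omega⟩ with
          ⟨h3', h4', e'⟩ | ⟨h3', h4', e'⟩ | ⟨h3', h4', e'⟩ | ⟨h3', h4', e'⟩
        · have := ct_pos_of_eq h4'
          simp only [h7] at e'
          omega
        · simp_all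
        · rw [← ct_lt_ct_iff h4'] at hlt
          simp only [h7] at e'
          omega
        · simp_all

/-- The labels `L` mark the rows of the left-to-right records. -/
theorem Y_eq_L_iff (h : ω.IsRectangular) (hσ : ∀ k, ω.Rel k (σ k)) (k : Fin n) :
    ω.Y (σ k) = LR.L ↔ IsLRMax σ k ∨ IsLRMin σ k := by
  have hpos : 0 < n := (Nat.zero_le _).trans_lt ω.anchor.2
  constructor
  · intro hY
    cases hX : ω.X k
    · exact Or.inl (h.isLRMax_of_UL hσ hX hY)
    · exact Or.inr (h.isLRMin_of_DL hσ hX hY)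
  · intro hrec
    by_contra hL
    rcases hσ k with ⟨h3, h4, e⟩ | ⟨h3, h4, e⟩ | ⟨h3, h4, e⟩ | ⟨h3, h4, e⟩
    · exact hL h4
    · exact hL h4
    · rcases hrec with hm | hm
      · exact absurd hm.le_apply (not_le.2 (h.side_DR _ _ h3 h4 e))
      -- The lowest point stands at the anchor, to the left of every `D`–`R` point.
      · have h1 := h.apply_anchor hσ
        have h2 : ω.anchor < k := by
          rw [← ct_lt_ct_iff h3]
          have h7 : ct ω.X UD.D (ω.anchor + 1) = ω.anchorRank := rfl
          have := ct_pos_of_eq h4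
          omega
        have := hm _ h2
        rw [Fin.lt_def] at this
        omega
    · rcases hrec with hm | hm
      -- The top row is an `L` of rank greater than `c`, hence is matched to a `U`, and this column
      -- precedes all those of the `U`–`R` family.
      · have hYl := h.good.Y_last ⟨n - 1, by omega⟩ (by simp only; omega)
        set l : Fin n := ⟨n - 1, by omega⟩ with hl
        have h7 : (l : ℕ) + 1 = n := by simp only [hl]; omega
        obtain ⟨j, hj⟩ := σ.surjective l
        have hrel := hσ j
        rw [hj] at hrel
        have h1 := h.rank_lt_L
        have h5 := ct_L_add_ct_R ω.Y le_rfl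
        have h6 := ct_le_ct_length (s := ω.Y) (a := LR.R) (σ k)
        have hjk : j < k := by
          rw [← ct_lt_ct_iff h3]
          rcases hrel with ⟨h3', h4', e'⟩ | ⟨h3', h4', e'⟩ | ⟨h3', h4', e'⟩ | ⟨h3', h4', e'⟩
          · have := ct_pos_of_eq h3'
            rw [h7] at e'
            omega
          · rw [h7] at e'
            omega
          · exact absurd (hYl.symm.trans h4') (by decide)
          · exact absurd (hYl.symm.trans h4') (by decide)
        have := hm j hjk
        rw [hj, Fin.lt_def] at this
        have := (σ k).2
        omega
      · exact absurd hm.add_apply_lt (not_lt.2 (h.side_UR _ _ h3 h4 e))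

theorem rho_mem_Sq (h : ω.IsRectangular) : rho ω ∈ Sq n := h.mem_Sq (rel_rho h.isBalanced)

/-- A rectangular anchored pair can be recovered from its permutation. -/
theorem rho_injOn : Set.InjOn rho {ω : Anchored n | ω.IsRectangular} := by
  intro ω h ω' h' e
  have hσ := rel_rho h.isBalanced
  have hσ' := rel_rho h'.isBalanced
  rw [← e] at hσ'
  have h1 : ω.X = ω'.X := by
    funext k
    have := (h.X_eq_D_iff hσ k).trans (h'.X_eq_D_iff hσ' k).symm
    cases hk : ω.X k <;> cases hk' : ω'.X k <;> simp_all
  have h2 : ω.Y = ω'.Y := by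
    funext l
    obtain ⟨k, rfl⟩ := (rho ω).surjective l
    have := (h.Y_eq_L_iff hσ k).trans (h'.Y_eq_L_iff hσ' k).symm
    cases hk : ω.Y (rho ω k) <;> cases hk' : ω'.Y (rho ω k) <;> simp_all
  have h3 : ω.anchor = ω'.anchor := (rho ω).injective
    (Fin.ext ((h.apply_anchor hσ).trans (h'.apply_anchor hσ').symm))
  cases ω
  cases ω'
  simp_all

end IsRectangular

end Anchored
end SquarePerm

namespace SquarePerm

/-! ### The anchored pair of a square permutation. -/

section Encoding

variable {n : ℕ} (σ : Equiv.Perm (Fin n))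

open Classical in
/-- The column labels of a permutation: `D` marks the lower records. -/
noncomputable def columnLabel (k : Fin n) : UD :=
  if IsLRMin σ k ∨ IsRLMin σ k then UD.D else UD.U

open Classical in
/-- The row labels of a permutation. The left-to-right maxima that are right-to-left minima but not
left-to-right minima are labelled `R`. -/
noncomputable def rowLabel (l : Fin n) : LR :=
  if IsLRMin σ (σ.symm l) ∨ (IsLRMax σ (σ.symm l) ∧ ¬ IsRLMin σ (σ.symm l)) then LR.L else LR.R

open Classical in
/-- The number of left-to-right minima. -/
noncomputable def numLRMin : ℕ := (Finset.univ.filter fun k => IsLRMin σ k).card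

variable {σ}

theorem columnLabel_eq_D {k : Fin n} : columnLabel σ k = UD.D ↔ IsLRMin σ k ∨ IsRLMin σ k := by
  unfold columnLabel
  split_ifs with h <;> simp [h]

theorem columnLabel_eq_U {k : Fin n} : columnLabel σ k = UD.U ↔ ¬ IsLRMin σ k ∧ ¬ IsRLMin σ k := by
  unfold columnLabel
  split_ifs with h <;> simp [← not_or, h]

theorem rowLabel_eq_L {k : Fin n} :
    rowLabel σ (σ k) = LR.L ↔ IsLRMin σ k ∨ (IsLRMax σ k ∧ ¬ IsRLMin σ k) := by
  unfold rowLabel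
  rw [σ.symm_apply_apply]
  split_ifs with h <;> simp [h]

theorem rowLabel_eq_R {k : Fin n} :
    rowLabel σ (σ k) = LR.R ↔ ¬ IsLRMin σ k ∧ (IsLRMax σ k → IsRLMin σ k) := by
  unfold rowLabel
  rw [σ.symm_apply_apply]
  split_ifs with h
  · simp only [false_iff]
    tauto
  · simp only [true_iff]
    tauto

theorem ct_eq_sum {α : Type} [DecidableEq α] (s : Fin n → α) (a : α) (k : Fin n) :
    ct s a (k + 1) = ∑ j, if j ≤ k ∧ s j = a then 1 else 0 := by
  rw [ct, Finset.card_filter]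
  simp only [Nat.add_le_add_iff_right, Fin.val_fin_le]

theorem ct_eq_sum_comp {α : Type} [DecidableEq α] (s : Fin n → α) (a : α) (l : Fin n) :
    ct s a (l + 1) = ∑ j, if σ j ≤ l ∧ s (σ j) = a then 1 else 0 := by
  rw [ct_eq_sum, ← Equiv.sum_comp σ]

open Classical in
theorem numLRMin_eq_sum : numLRMin σ = ∑ j, if IsLRMin σ j then 1 else 0 := by
  rw [numLRMin, Finset.card_filter]

theorem sum_eq_one (k : Fin n) : ∑ j, (if j = k then 1 else 0) = 1 := by simp

/-- A square permutation is matched to itself by its labels. -/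
theorem matched_labels (h : σ ∈ Sq n) (k : Fin n) :
    Matched (columnLabel σ) (rowLabel σ) (numLRMin σ) k (σ k) := by
  classical
  rw [mem_Sq] at h
  have key : ∀ i j, i < j → (IsLRMin σ j → σ j < σ i) ∧ (IsRLMin σ i → σ i < σ j) ∧
      (IsLRMax σ j → σ i < σ j) ∧ (IsRLMax σ i → σ j < σ i) ∧ σ i ≠ σ j :=
    fun i j hij => ⟨fun h => h i hij, fun h => h j hij, fun h => h i hij, fun h => h j hij,
      fun e => hij.ne (σ.injective e)⟩
  by_cases hA : IsLRMin σ k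
  · refine Or.inl ⟨columnLabel_eq_D.2 (Or.inl hA), rowLabel_eq_L.2 (Or.inl hA), ?_⟩
    -- Every count is written as a sum of indicators over the points of `σ`. The rank equation then
    -- holds point by point, by comparing the point `j` with the point `k`; the extra `1` is the
    -- contribution of `j = k`.
    have hn : numLRMin σ + 1 =
        ∑ j, ((if IsLRMin σ j then 1 else 0) + if j = k then 1 else 0) := by
      rw [Finset.sum_add_distrib, sum_eq_one, numLRMin_eq_sum]
    rw [hn, ct_eq_sum (columnLabel σ), ct_eq_sum_comp (σ := σ) (rowLabel σ),
      ← Finset.sum_add_distrib]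
    refine Finset.sum_congr rfl fun j _ => ?_
    simp only [columnLabel_eq_D, rowLabel_eq_L]
    rcases lt_trichotomy j k with hj | rfl | hj
    · have := key j k hj
      clear key h
      grind
    · clear key h
      grind
    · have := key k j hj
      clear key h
      grind
  by_cases hB : IsRLMin σ k
  · refine Or.inr (Or.inr (Or.inl ⟨columnLabel_eq_D.2 (Or.inr hB),
      rowLabel_eq_R.2 ⟨hA, fun _ => hB⟩, ?_⟩))
    rw [ct_eq_sum (columnLabel σ), ct_eq_sum_comp (σ := σ) (rowLabel σ), numLRMin_eq_sum,
      ← Finset.sum_add_distrib]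
    refine Finset.sum_congr rfl fun j _ => ?_
    simp only [columnLabel_eq_D, rowLabel_eq_R]
    have := h j
    rcases lt_trichotomy j k with hj | rfl | hj
    · have := key j k hj
      clear key h
      grind
    · clear key h
      grind
    · have := key k j hj
      clear key h
      grind
  by_cases hC : IsLRMax σ k
  · refine Or.inr (Or.inl ⟨columnLabel_eq_U.2 ⟨hA, hB⟩, rowLabel_eq_L.2 (Or.inr ⟨hC, hB⟩), ?_⟩)
    rw [ct_eq_sum (columnLabel σ), ct_eq_sum_comp (σ := σ) (rowLabel σ), numLRMin_eq_sum,
      ← Finset.sum_add_distrib]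
    refine Finset.sum_congr rfl fun j _ => ?_
    simp only [columnLabel_eq_U, rowLabel_eq_L]
    have := h j
    rcases lt_trichotomy j k with hj | rfl | hj
    · have := key j k hj
      clear key h
      grind
    · clear key h
      grind
    · have := key k j hj
      clear key h
      grind
  · have hE : IsRLMax σ k := by have := h k; tauto
    refine Or.inr (Or.inr (Or.inr ⟨columnLabel_eq_U.2 ⟨hA, hB⟩,
      rowLabel_eq_R.2 ⟨hA, fun h => absurd h hC⟩, ?_⟩))
    have hn : n + 1 = ∑ j : Fin n, (1 + if j = k then 1 else 0) := by
      rw [Finset.sum_add_distrib, sum_eq_one]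
      simp
    rw [hn, ct_eq_sum (columnLabel σ), ct_eq_sum_comp (σ := σ) (rowLabel σ), numLRMin_eq_sum,
      ← Finset.sum_add_distrib,
      ← Finset.sum_add_distrib]
    refine Finset.sum_congr rfl fun j _ => ?_
    simp only [columnLabel_eq_U, rowLabel_eq_R]
    have := h j
    rcases lt_trichotomy j k with hj | rfl | hj
    · have := key j k hj
      clear key h
      grind
    · clear key h
      grind
    · have := key k j hj
      clear key h
      grind

/-- No left-to-right minimum lies to the right of the lowest point and no right-to-left minimum to
its left. So the column labels and the anchor determine the parameter `c`, whence `encode` is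
injective. -/
theorem ct_columnLabel_of_apply_eq_zero {m : Fin n} (hm : (σ m : ℕ) = 0) :
    ct (columnLabel σ) UD.D (m + 1) = numLRMin σ := by
  classical
  rw [ct_eq_sum, numLRMin_eq_sum]
  refine Finset.sum_congr rfl fun j _ => ?_
  simp only [columnLabel_eq_D]
  have hmin : ∀ j, ¬ σ j < σ m := fun j hj => by
    rw [Fin.lt_def] at hj
    omega
  have hA : IsLRMin σ m := fun j hj =>
    lt_of_le_of_ne (not_lt.1 (hmin j)) fun e => hj.ne' (σ.injective e)
  have h1 : IsLRMin σ j → j ≤ m := fun h => not_lt.1 fun hj => hmin j (h m hj)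
  have h2 : IsRLMin σ j → m ≤ j := fun h => not_lt.1 fun hj => hmin j (h m hj)
  have h3 : j = m → IsLRMin σ j := fun e => e ▸ hA
  have h4 : j ≤ m → m ≤ j → j = m := le_antisymm
  congr 1
  rw [eq_iff_iff]
  tauto

/-- The labels and the number of left-to-right minima determine a square permutation. -/
theorem eq_of_labels_eq {τ : Equiv.Perm (Fin n)} (hσ : σ ∈ Sq n) (hτ : τ ∈ Sq n)
    (hX : columnLabel σ = columnLabel τ) (hY : rowLabel σ = rowLabel τ)
    (hc : numLRMin σ = numLRMin τ) : σ = τ := by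
  refine Equiv.ext fun k => (matched_labels hσ k).right_unique ?_
  rw [hX, hY, hc]
  exact matched_labels hτ k

/-- The anchored pair of a permutation, anchored at the column of the lowest point. -/
noncomputable def encode [NeZero n] (σ : Equiv.Perm (Fin n)) : Anchored n :=
  ⟨columnLabel σ, rowLabel σ, σ.symm 0⟩

theorem encode_injOn [NeZero n] : Set.InjOn encode (Sq n : Set (Equiv.Perm (Fin n))) := by
  intro σ hσ τ hτ h
  rw [encode, encode, Anchored.mk.injEq] at h
  obtain ⟨hX, hY, h0⟩ := h
  refine eq_of_labels_eq hσ hτ hX hY ?_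
  rw [← ct_columnLabel_of_apply_eq_zero (σ := σ) (m := σ.symm 0) (by simp),
    ← ct_columnLabel_of_apply_eq_zero (σ := τ) (m := τ.symm 0) (by simp), hX, h0]

theorem encode_isGood [NeZero n]
    (h : ∀ k : Fin n, (k : ℕ) + 1 = n → (σ k : ℕ) + 1 ≠ n) : (encode σ).IsGood where
  X_first k hk := columnLabel_eq_D.2 (Or.inl fun j hj => by
    rw [Fin.lt_def] at hj
    omega)
  X_last k hk := columnLabel_eq_D.2 (Or.inr fun j hj => by
    rw [Fin.lt_def] at hj
    omega)
  X_anchor := columnLabel_eq_D.2 (Or.inl fun j hj => by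
    change σ (σ.symm 0) < σ j
    rw [σ.apply_symm_apply, Fin.pos_iff_ne_zero]
    intro h0
    exact hj.ne (σ.eq_symm_apply.2 h0))
  Y_first l hl := by
    obtain ⟨k, rfl⟩ := σ.surjective l
    refine rowLabel_eq_L.2 (Or.inl fun j hj => ?_)
    have : σ j ≠ σ k := fun e => hj.ne (σ.injective e)
    rw [Ne, Fin.ext_iff] at this
    rw [Fin.lt_def]
    omega
  Y_last l hl := by
    obtain ⟨k, rfl⟩ := σ.surjective l
    have hne : ∀ j, j ≠ k → σ j < σ k := fun j hj => by
      have : σ j ≠ σ k := fun e => hj (σ.injective e)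
      rw [Ne, Fin.ext_iff] at this
      have := (σ j).2
      rw [Fin.lt_def]
      omega
    -- The highest point is always a left-to-right maximum; it could be labelled `R` only as a
    -- right-to-left minimum, which would place it in the last column.
    refine rowLabel_eq_L.2 (Or.inr ⟨fun j hj => hne j hj.ne, fun hmin => ?_⟩)
    by_cases hk : (k : ℕ) + 1 = n
    · exact h k hk hl
    · have hlt : k < ⟨k + 1, by omega⟩ := by
        rw [Fin.lt_def]
        simp
      exact lt_asymm (hmin _ hlt) (hne _ hlt.ne')

/-- If the last point is the highest one, there are no points with labels `U` and `R`. -/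
theorem numLRMin_add_of_last (hσ : σ ∈ Sq n) {k : Fin n} (hk : (k : ℕ) + 1 = n)
    (hk' : (σ k : ℕ) + 1 = n) :
    numLRMin σ + ct (columnLabel σ) UD.U n = ct (rowLabel σ) LR.L n := by
  classical
  have hmax : ∀ j, j ≤ k ∧ σ j ≤ σ k := fun j => by
    have := j.2
    have := (σ j).2
    rw [Fin.le_def, Fin.le_def]
    omega
  have hlast : IsRLMin σ k := fun j hj => absurd (hmax j).1 (not_le.2 hj)
  have h1 := ct_eq_sum (columnLabel σ) UD.U k
  have h2 := ct_eq_sum_comp (σ := σ) (rowLabel σ) LR.L (σ k)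
  rw [hk] at h1
  rw [hk'] at h2
  rw [h1, h2, numLRMin_eq_sum, ← Finset.sum_add_distrib]
  refine Finset.sum_congr rfl fun j _ => ?_
  simp only [columnLabel_eq_U, rowLabel_eq_L, hmax, true_and]
  have hsq := mem_Sq.1 hσ j
  -- With the last point highest, it is the only right-to-left maximum, and it is also a
  -- right-to-left minimum. So every column labelled `U` carries a left-to-right maximum.
  have h3 : IsRLMax σ j → j = k := fun h => by
    by_contra hne
    exact absurd (h k (lt_of_le_of_ne (hmax j).1 hne)) (not_lt.2 (hmax j).2)
  have h4 : IsRLMax σ j → IsRLMin σ j := fun h => by rw [h3 h]; exact hlast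
  grind

end Encoding

/-! ### Upper bound for the number of square permutations. -/

section Counting

variable {n : ℕ}

instance : Fintype UD := ⟨{UD.U, UD.D}, fun x => by cases x <;> simp⟩

instance : Fintype LR := ⟨{LR.L, LR.R}, fun x => by cases x <;> simp⟩

@[simp] theorem card_UD : Fintype.card UD = 2 := rfl

@[simp] theorem card_LR : Fintype.card LR = 2 := rfl

namespace Anchored

/-- Anchored pairs as triples. -/
def equivProd : Anchored n ≃ (Fin n → UD) × (Fin n → LR) × Fin n where
  toFun ω := (ω.X, ω.Y, ω.anchor)
  invFun t := ⟨t.1, t.2.1, t.2.2⟩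
  left_inv _ := rfl
  right_inv _ := rfl

instance : Finite (Anchored n) := Finite.of_equiv _ equivProd.symm

end Anchored

/-- The square permutations are not much more numerous than the good anchored pairs. -/
theorem card_Sq_le (n : ℕ) [NeZero n] :
    (Sq n).card ≤ {ω : Anchored n | ω.IsGood}.ncard + 4 ^ n := by
  classical
  let p : Equiv.Perm (Fin n) → Prop := fun σ => ∃ k : Fin n, (k : ℕ) + 1 = n ∧ (σ k : ℕ) + 1 = n
  rw [← Finset.card_filter_add_card_filter_not (s := Sq n) p, add_comm]
  refine Nat.add_le_add ?_ ?_
  · rw [← Set.ncard_coe_finset]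
    refine Set.ncard_le_ncard_of_injOn encode (fun σ hσ => ?_) (fun σ hσ τ hτ h => ?_)
      (Set.toFinite _)
    · simp only [Finset.coe_filter, Set.mem_ofPred_eq] at hσ
      exact encode_isGood fun k hk hk' => hσ.2 ⟨k, hk, hk'⟩
    · simp only [Finset.coe_filter, Set.mem_ofPred_eq] at hσ hτ
      exact encode_injOn (Finset.mem_coe.2 hσ.1) (Finset.mem_coe.2 hτ.1) h
  -- When `σ(n) = n` the labels alone give the parameter, as `c = #L - #U`, so no anchor is needed
  -- and the factor `n` is saved.
  · have hcard : (Finset.univ : Finset ((Fin n → UD) × (Fin n → LR))).card = 4 ^ n := by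
      rw [Finset.card_univ, Fintype.card_prod, Fintype.card_fun, Fintype.card_fun, card_UD,
        card_LR, Fintype.card_fin, ← mul_pow]
      norm_num
    rw [← hcard]
    refine Finset.card_le_card_of_injOn (fun σ => (columnLabel σ, rowLabel σ))
      (fun _ _ => Finset.mem_coe.2 (Finset.mem_univ _)) (fun σ hσ τ hτ h => ?_)
    simp only [Finset.coe_filter, Set.mem_ofPred_eq] at hσ hτ
    rw [Prod.mk.injEq] at h
    obtain ⟨hσ, k, hk, hσk⟩ := hσ
    obtain ⟨hτ, k', hk', hτk⟩ := hτ
    refine eq_of_labels_eq hσ hτ h.1 h.2 ?_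
    have h1 := numLRMin_add_of_last hσ hk hσk
    have h2 := numLRMin_add_of_last hτ hk' hτk
    rw [h.1, h.2] at h1
    omega

end Counting

end SquarePerm

namespace SquarePerm

/-! ### Hoeffding's inequality by counting sequences. -/

section Concentration

variable {α : Type} [DecidableEq α] {n : ℕ}

/-- The deviations of the numbers of labels `a` between two indices at distance `m` from `m / 2` are
at most `√(m q)`. -/
def HasSmallDeviations (s : Fin n → α) (a : α) (q : ℝ) : Prop :=
  ∀ i j : ℕ, i ≤ n → j ≤ n →
    ((ct s a i : ℝ) - ct s a j - 1 / 2 * ((i : ℝ) - j)) ^ 2 ≤ |(i : ℝ) - j| * q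

/-- The steps of the random walk associated with a label. -/
def step (a x : α) : ℝ := if x = a then 1 else -1

theorem sum_step (s : Fin n → α) (a : α) {i j : ℕ} (hij : j ≤ i) (hi : i ≤ n) :
    ∑ k ∈ (Finset.univ.filter fun k : Fin n => j ≤ (k : ℕ) ∧ (k : ℕ) < i), step a (s k)
      = 2 * ((ct s a i : ℝ) - ct s a j - 1 / 2 * ((i : ℝ) - j)) := by
  induction i, hij using Nat.le_induction with
  | base =>
    rw [Finset.sum_eq_zero]
    · ring
    · intro k hk
      simp only [Finset.mem_filter] at hk
      omega
  | succ i hij ih =>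
    have ih := ih (by omega)
    have hset : (Finset.univ.filter fun k : Fin n => j ≤ (k : ℕ) ∧ (k : ℕ) < i + 1)
        = insert ⟨i, hi⟩ (Finset.univ.filter fun k : Fin n => j ≤ (k : ℕ) ∧ (k : ℕ) < i) := by
      ext k
      simp only [Finset.mem_filter, Finset.mem_univ, true_and, Finset.mem_insert, Fin.ext_iff]
      omega
    rw [hset, Finset.sum_insert (by simp), ih]
    by_cases h : s ⟨i, hi⟩ = a
    · have := ct_succ_of_eq s a h
      simp only at this
      rw [this, step, if_pos h]
      push_cast
      ring
    · have := ct_succ_of_ne s a h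
      simp only at this
      rw [this, step, if_neg h]
      push_cast
      ring

variable [Fintype α]

theorem sum_exp_step (hα : Fintype.card α = 2) (a : α) (t : ℝ) :
    ∑ x, Real.exp (t * step a x) = 2 * Real.cosh t := by
  have h1 : (Finset.univ.erase a).card = 1 := by
    rw [Finset.card_erase_of_mem (Finset.mem_univ a), Finset.card_univ, hα]
  rw [← Finset.add_sum_erase _ _ (Finset.mem_univ a),
    Finset.sum_congr rfl (g := fun _ => Real.exp (-t)) fun x hx => by
      rw [step, if_neg (Finset.ne_of_mem_erase hx), mul_neg, mul_one],
    Finset.sum_const, h1, step, if_pos rfl, Real.cosh_eq, one_smul, mul_one]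
  ring

/-- This is the moment generating function without normalisation: the sum over sequences factors
over the indices, each contributing `2 cosh t` inside `I` and `2` outside, and `cosh t ≤ exp (t ^ 2
/ 2)`. -/
theorem sum_exp_sum_step_le (hα : Fintype.card α = 2) (a : α) (I : Finset (Fin n)) (t : ℝ) :
    ∑ s : Fin n → α, Real.exp (t * ∑ k ∈ I, step a (s k))
      ≤ 2 ^ n * Real.exp (I.card * t ^ 2 / 2) := by
  have h1 : ∀ s : Fin n → α, Real.exp (t * ∑ k ∈ I, step a (s k))
      = ∏ k, if k ∈ I then Real.exp (t * step a (s k)) else 1 := fun s => by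
    rw [Finset.mul_sum, Real.exp_sum, Finset.prod_ite_mem, Finset.univ_inter]
  have h2 : ∀ k : Fin n, (∑ x : α, if k ∈ I then Real.exp (t * step a x) else 1)
      = 2 * if k ∈ I then Real.cosh t else 1 := fun k => by
    split_ifs
    · exact sum_exp_step hα a t
    · simp [hα]
  have h3 := Finset.prod_univ_sum (fun _ : Fin n => (Finset.univ : Finset α))
    (fun k x => if k ∈ I then Real.exp (t * step a x) else 1)
  rw [Fintype.piFinset_univ] at h3
  rw [Finset.sum_congr rfl fun s _ => h1 s, ← h3, Finset.prod_congr rfl fun k _ => h2 k,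
    Finset.prod_mul_distrib, Finset.prod_const, Finset.card_univ, Fintype.card_fin,
    Finset.prod_ite_mem, Finset.univ_inter, Finset.prod_const]
  refine mul_le_mul_of_nonneg_left ?_ (by positivity)
  calc Real.cosh t ^ I.card ≤ Real.exp (t ^ 2 / 2) ^ I.card :=
        pow_le_pow_left₀ (Real.cosh_pos t).le (Real.cosh_le_exp_half_sq t) _
    _ = Real.exp (I.card * t ^ 2 / 2) := by
        rw [← Real.exp_nat_mul]
        ring_nf

/-- Chernoff's argument: each counted sequence contributes at least `exp c` to the exponential sum.
-/
theorem card_le_exp_of_le_sum_step (hα : Fintype.card α = 2) (a : α) (I : Finset (Fin n))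
    (c t : ℝ) (p : (Fin n → α) → Prop) [DecidablePred p]
    (hp : ∀ s, p s → c ≤ t * ∑ k ∈ I, step a (s k)) :
    ((Finset.univ.filter p).card : ℝ) ≤ 2 ^ n * Real.exp (I.card * t ^ 2 / 2 - c) := by
  rw [Real.exp_sub, ← mul_div_assoc, le_div_iff₀ (Real.exp_pos c)]
  refine le_trans ?_ (sum_exp_sum_step_le hα a I t)
  rw [← nsmul_eq_mul, ← Finset.sum_const]
  refine (Finset.sum_le_sum fun s hs => ?_).trans
    (Finset.sum_le_sum_of_subset_of_nonneg (Finset.filter_subset p _) fun s _ _ =>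
      (Real.exp_pos _).le)
  exact Real.exp_le_exp.2 (hp s (Finset.mem_filter.1 hs).2)

open Classical in
/-- Hoeffding's inequality for the number of labels between two indices. -/
theorem card_large_deviation_le (hα : Fintype.card α = 2) (a : α) {i j : ℕ} (hij : j ≤ i)
    (hi : i ≤ n) {q : ℝ} (hq : 0 ≤ q) :
    ((Finset.univ.filter fun s : Fin n → α => ((i : ℝ) - j) * q
      < ((ct s a i : ℝ) - ct s a j - 1 / 2 * ((i : ℝ) - j)) ^ 2).card : ℝ)
      ≤ 2 * (2 ^ n * Real.exp (-2 * q)) := by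
  rcases hij.eq_or_lt with rfl | hlt
  · simp only [sub_self, mul_zero, zero_mul, ne_eq, OfNat.ofNat_ne_zero, not_false_eq_true,
      zero_pow, lt_self_iff_false, Finset.filter_false, Finset.card_empty, Nat.cast_zero]
    positivity
  set I : Finset (Fin n) := Finset.univ.filter fun k : Fin n => j ≤ (k : ℕ) ∧ (k : ℕ) < i with hI
  have hm : (0 : ℝ) < (i : ℝ) - j := by
    rw [sub_pos]
    exact_mod_cast hlt
  have hcard : (I.card : ℝ) = (i : ℝ) - j := by
    have : I.card = i - j := by
      rw [← Nat.card_Ico, ← Finset.card_map Fin.valEmbedding]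
      congr 1
      ext k
      simp only [hI, Finset.mem_map, Finset.mem_filter, Finset.mem_univ, true_and,
        Fin.valEmbedding_apply, Finset.mem_Ico]
      exact ⟨fun ⟨l, h, e⟩ => e ▸ h, fun h => ⟨⟨k, by omega⟩, h, rfl⟩⟩
    rw [this, Nat.cast_sub hij]
  set m : ℝ := (i : ℝ) - j with hmdef
  -- The parameter `t = ±2r` optimises the Chernoff bound: `m t ^ 2 / 2 - 4q = 2q - 4q = -2q`.
  set r : ℝ := √(q / m) with hr
  have hr2 : r ^ 2 = q / m := Real.sq_sqrt (by positivity)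
  have hr0 : 0 ≤ r := Real.sqrt_nonneg _
  have hmr : m * r ^ 2 = q := by
    rw [hr2]
    field_simp
  have key : ∀ s : Fin n → α, m * q < ((ct s a i : ℝ) - ct s a j - 1 / 2 * m) ^ 2 →
      4 * q ≤ 2 * r * ∑ k ∈ I, step a (s k) ∨ 4 * q ≤ -(2 * r) * ∑ k ∈ I, step a (s k) := by
    intro s hs
    rw [sum_step s a hij hi, ← hmdef]
    set e : ℝ := (ct s a i : ℝ) - ct s a j - 1 / 2 * m
    have h1 : (m * r) ^ 2 ≤ e ^ 2 := by
      rw [mul_pow, sq m, mul_assoc, hmr]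
      exact hs.le
    have h2 : m * r ≤ |e| := by
      rw [← abs_of_nonneg (by positivity : 0 ≤ m * r)]
      exact sq_le_sq.1 h1
    have h3 : q ≤ r * |e| := by
      calc q = r * (m * r) := by rw [← hmr]; ring
        _ ≤ r * |e| := mul_le_mul_of_nonneg_left h2 hr0
    rcases abs_cases e with ⟨h, -⟩ | ⟨h, -⟩ <;> rw [h] at h3
    · left; linarith
    · right; linarith
  have hb : ∀ t : ℝ, t ^ 2 = (2 * r) ^ 2 →
      ((Finset.univ.filter fun s : Fin n → α => 4 * q ≤ t * ∑ k ∈ I, step a (s k)).card : ℝ)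
        ≤ 2 ^ n * Real.exp (-2 * q) := by
    intro t ht
    refine (card_le_exp_of_le_sum_step hα a I (4 * q) t _ fun s hs => hs).trans (le_of_eq ?_)
    congr 2
    rw [ht, hcard]
    linarith
  have hsub : (Finset.univ.filter fun s : Fin n → α => m * q
      < ((ct s a i : ℝ) - ct s a j - 1 / 2 * m) ^ 2)
      ⊆ (Finset.univ.filter fun s : Fin n → α => 4 * q ≤ 2 * r * ∑ k ∈ I, step a (s k)) ∪
        (Finset.univ.filter fun s : Fin n → α => 4 * q ≤ -(2 * r) * ∑ k ∈ I, step a (s k)) := by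
    intro s hs
    simp only [Finset.mem_filter, Finset.mem_univ, true_and, Finset.mem_union] at hs ⊢
    exact key s hs
  have h1 : ((Finset.univ.filter fun s : Fin n → α => m * q
      < ((ct s a i : ℝ) - ct s a j - 1 / 2 * m) ^ 2).card : ℝ) ≤ _ :=
    Nat.cast_le.2 ((Finset.card_le_card hsub).trans (Finset.card_union_le _ _))
  rw [Nat.cast_add] at h1
  have h2 := hb (2 * r) rfl
  have h3 := hb (-(2 * r)) (neg_sq _)
  linarith

open Classical in
theorem card_not_hasSmallDeviations_le (hα : Fintype.card α = 2) (a : α) {q : ℝ} (hq : 0 ≤ q) :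
    ((Finset.univ.filter fun s : Fin n → α => ¬ HasSmallDeviations s a q).card : ℝ)
      ≤ (n + 1 : ℝ) ^ 2 * (2 * (2 ^ n * Real.exp (-2 * q))) := by
  set P : Finset (ℕ × ℕ) := Finset.range (n + 1) ×ˢ Finset.range (n + 1)
  let B : ℕ × ℕ → Finset (Fin n → α) := fun p =>
    if p.2 ≤ p.1 then Finset.univ.filter fun s : Fin n → α => ((p.1 : ℝ) - p.2) * q
      < ((ct s a p.1 : ℝ) - ct s a p.2 - 1 / 2 * ((p.1 : ℝ) - p.2)) ^ 2 else ∅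
  have hsub : (Finset.univ.filter fun s : Fin n → α => ¬ HasSmallDeviations s a q)
      ⊆ P.biUnion B := by
    intro s hs
    simp only [Finset.mem_filter, Finset.mem_univ, true_and, HasSmallDeviations, not_forall,
      not_le] at hs
    obtain ⟨i, j, hi, hj, h⟩ := hs
    rw [Finset.mem_biUnion]
    rcases le_total j i with hij | hij
    · refine ⟨(i, j), by simp only [P, Finset.mem_product, Finset.mem_range]; omega, ?_⟩
      simp only [B, if_pos hij, Finset.mem_filter, Finset.mem_univ, true_and]
      rwa [abs_of_nonneg (by rw [sub_nonneg]; exact_mod_cast hij)] at h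
    · refine ⟨(j, i), by simp only [P, Finset.mem_product, Finset.mem_range]; omega, ?_⟩
      simp only [B, if_pos hij, Finset.mem_filter, Finset.mem_univ, true_and]
      rw [abs_sub_comm, abs_of_nonneg (by rw [sub_nonneg]; exact_mod_cast hij)] at h
      refine h.trans_eq ?_
      ring
  have hB : ∀ p ∈ P, ((B p).card : ℝ) ≤ 2 * (2 ^ n * Real.exp (-2 * q)) := by
    intro p hp
    simp only [P, Finset.mem_product, Finset.mem_range] at hp
    by_cases h : p.2 ≤ p.1
    · simp only [B, if_pos h]
      exact card_large_deviation_le hα a h (by omega) hq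
    · simp only [B, if_neg h, Finset.card_empty, Nat.cast_zero]
      positivity
  calc _ ≤ ((P.biUnion B).card : ℝ) := Nat.cast_le.2 (Finset.card_le_card hsub)
    _ ≤ ((∑ p ∈ P, (B p).card : ℕ) : ℝ) := Nat.cast_le.2 Finset.card_biUnion_le
    _ = ∑ p ∈ P, ((B p).card : ℝ) := Nat.cast_sum _ _
    _ ≤ P.card • (2 * (2 ^ n * Real.exp (-2 * q))) := Finset.sum_le_card_nsmul _ _ _ hB
    _ = _ := by
      rw [nsmul_eq_mul, Finset.card_product, Finset.card_range]
      push_cast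
      ring

end Concentration

/-! ### From small deviations to the Petrov conditions. -/

section Petrov

/-- Serves with `x` a difference of ranks and `y` the difference of positions: the deviation bound
for counts involves the unknown `|y|`, which is here bounded by the known `|x|`. If it failed, then
`|x - y / 2| > |y| / 4`, so `|y| < 16q`. -/
theorem abs_le_of_sq_le {x y q : ℝ} (hq : 0 ≤ q) (h : (x - 1 / 2 * y) ^ 2 ≤ |y| * q) :
    |y| ≤ 4 * |x| + 16 * q := by
  by_contra hlt
  rw [not_le] at hlt
  have h1 : |y| / 2 - |x| ≤ |x - 1 / 2 * y| := by
    have := abs_sub_abs_le_abs_sub (1 / 2 * y) x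
    rw [abs_mul, abs_of_pos (by norm_num : (0 : ℝ) < 1 / 2), abs_sub_comm] at this
    linarith
  have h2 := abs_nonneg x
  have h3 : |y| / 4 < |x - 1 / 2 * y| := by linarith
  rw [← sq_abs] at h
  have h4 : 0 < |y| := by linarith
  nlinarith

theorem eventually_mul_rpow_le (C : ℝ) {a b : ℝ} (hab : a < b) :
    ∀ᶠ n : ℕ in atTop, C * (n : ℝ) ^ a ≤ (n : ℝ) ^ b := by
  have h1 : Tendsto (fun n : ℕ => (n : ℝ) ^ (b - a)) atTop atTop :=
    (tendsto_rpow_atTop (sub_pos.2 hab)).comp tendsto_natCast_atTop_atTop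
  filter_upwards [h1.eventually_ge_atTop C, eventually_gt_atTop 0] with n hn h0
  have hn0 : (0 : ℝ) < n := Nat.cast_pos.2 h0
  calc C * (n : ℝ) ^ a ≤ (n : ℝ) ^ (b - a) * (n : ℝ) ^ a :=
        mul_le_mul_of_nonneg_right hn (by positivity)
    _ = (n : ℝ) ^ b := by rw [← Real.rpow_add hn0, sub_add_cancel]

/-- Take `q = n ^ 0.05`. For distances below `n ^ 0.6` the squared deviation is of order at most `n
^ 0.65`, below `(n ^ 0.4) ^ 2`. For a distance `x > n ^ 0.3`, `q` is negligible against `n ^ 0.06 <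
x ^ 0.2`, so `x * q` is negligible against `(x ^ 0.6) ^ 2`. -/
theorem petrovLabel_of_hasSmallDeviations : ∀ᶠ n : ℕ in atTop,
    ∀ {α : Type} [DecidableEq α] (s : Fin n → α) (a : α),
      HasSmallDeviations s a ((n : ℝ) ^ (1 / 20 : ℝ)) → PetrovLabel s a := by
  filter_upwards [eventually_mul_rpow_le 80 (by norm_num : (13 / 20 : ℝ) < 4 / 5),
    eventually_mul_rpow_le 20 (by norm_num : (1 / 20 : ℝ) < 3 / 50), eventually_ge_atTop 1]
    with n h1 h2 hn α _ s a h
  have hn1 : (1 : ℝ) ≤ n := by exact_mod_cast hn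
  have hn0 : (0 : ℝ) < n := by linarith
  set q : ℝ := (n : ℝ) ^ (1 / 20 : ℝ) with hq
  have hq1 : 1 ≤ q := Real.one_le_rpow hn1 (by norm_num)
  have hq3 : q ≤ (n : ℝ) ^ (3 / 10 : ℝ) := Real.rpow_le_rpow_of_exponent_le hn1 (by norm_num)
  have hq6 : q ≤ (n : ℝ) ^ (3 / 5 : ℝ) := Real.rpow_le_rpow_of_exponent_le hn1 (by norm_num)
  have e1 : (n : ℝ) ^ (3 / 5 : ℝ) * q = (n : ℝ) ^ (13 / 20 : ℝ) := by
    rw [hq, ← Real.rpow_add hn0]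
    norm_num
  have e2 : ((n : ℝ) ^ (2 / 5 : ℝ)) ^ 2 = (n : ℝ) ^ (4 / 5 : ℝ) := by
    rw [← Real.rpow_natCast, ← Real.rpow_mul hn0.le]
    norm_num
  have hpos : 0 < (n : ℝ) ^ (13 / 20 : ℝ) := by positivity
  have near : ∀ x e : ℝ, 0 ≤ x → x < (n : ℝ) ^ (3 / 5 : ℝ) → e ^ 2 ≤ 80 * (x * q) →
      e ^ 2 < 80 * ((n : ℝ) ^ (3 / 5 : ℝ) * q) := fun x e _ hx he => by
    have := mul_lt_mul_of_pos_right hx (by linarith : 0 < q)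
    linarith
  have far : ∀ x : ℝ, (n : ℝ) ^ (3 / 10 : ℝ) < x → 20 * (x * q) < (x ^ (3 / 5 : ℝ)) ^ 2 := by
    intro x hx
    have hx0 : 0 < x := lt_trans (by positivity) hx
    have h3 : (n : ℝ) ^ (3 / 50 : ℝ) < x ^ (1 / 5 : ℝ) := by
      calc (n : ℝ) ^ (3 / 50 : ℝ) = ((n : ℝ) ^ (3 / 10 : ℝ)) ^ (1 / 5 : ℝ) := by
            rw [← Real.rpow_mul hn0.le]
            norm_num
        _ < x ^ (1 / 5 : ℝ) := Real.rpow_lt_rpow (by positivity) hx (by norm_num)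
    have h4 : (x ^ (3 / 5 : ℝ)) ^ 2 = x * x ^ (1 / 5 : ℝ) := by
      rw [← Real.rpow_natCast, ← Real.rpow_mul hx0.le]
      nth_rewrite 2 [← Real.rpow_one x]
      rw [← Real.rpow_add hx0]
      norm_num
    rw [h4]
    have := mul_lt_mul_of_pos_left (h2.trans_lt h3) hx0
    linarith
  have hpn : ∀ i, pos s a i ≤ n := fun i => pos_le_length
  -- Deviations of positions are those of counts, evaluated at positions and doubled. Since `4 * (4x
  -- + 16q) * q ≤ 80 * x * q` once `q ≤ x`, the constants 80 and 20 = 80 / 4 suffice.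
  have hp : ∀ i j : ℕ, i ≤ ct s a n → j ≤ ct s a n →
      ((pos s a i : ℝ) - pos s a j - 2 * ((i : ℝ) - j)) ^ 2
        ≤ 4 * ((4 * |(i : ℝ) - j| + 16 * q) * q) := by
    intro i j hi hj
    have h3 := h (pos s a i) (pos s a j) (hpn i) (hpn j)
    rw [ct_pos hi, ct_pos hj] at h3
    have h4 := abs_le_of_sq_le (by linarith) h3
    have h5 := mul_le_mul_of_nonneg_right h4 (by linarith : 0 ≤ q)
    calc ((pos s a i : ℝ) - pos s a j - 2 * ((i : ℝ) - j)) ^ 2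
        = 4 * ((i : ℝ) - j - 1 / 2 * ((pos s a i : ℝ) - pos s a j)) ^ 2 := by ring
      _ ≤ _ := by linarith
  constructor
  · intro i j hi hj hij
    have h3 := h i j hi hj
    refine abs_lt_of_sq_lt_sq ?_ (by positivity)
    rw [e2]
    have := mul_lt_mul_of_pos_right hij (by linarith : 0 < q)
    linarith
  · intro i j hi hj hij
    have h3 := h i j hi hj
    refine abs_lt_of_sq_lt_sq ?_ (by positivity)
    have h4 := far _ hij
    have h5 : 0 ≤ |(i : ℝ) - j| * q := mul_nonneg (abs_nonneg _) (by linarith)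
    rw [mul_pow]
    have h6 : 0 < (|(i : ℝ) - j| ^ (3 / 5 : ℝ)) ^ 2 := by linarith
    linarith
  · intro i j hi hj hij
    have h3 := hp i j hi hj
    refine abs_lt_of_sq_lt_sq ?_ (by positivity)
    rw [e2]
    have h4 := mul_lt_mul_of_pos_right hij (by linarith : 0 < q)
    have h5 := mul_le_mul_of_nonneg_right hq6 (by linarith : 0 ≤ q)
    linarith
  · intro i j hi hj hij
    have h3 := hp i j hi hj
    refine abs_lt_of_sq_lt_sq ?_ (by positivity)
    have h4 := far _ hij
    have h5 := mul_le_mul_of_nonneg_right (hq3.trans hij.le) (by linarith : 0 ≤ q)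
    rw [mul_pow]
    linarith

end Petrov

end SquarePerm

namespace SquarePerm

/-! ### Regular anchored pairs are rectangular. -/

section Regular

variable {α : Type} [DecidableEq α] {n : ℕ}

theorem PetrovLabel.abs_ct_sub_half_le {s : Fin n → α} {a : α} (h : PetrovLabel s a) (hn : 2 ≤ n)
    {i : ℕ} (hi : i ≤ n) : |(ct s a i : ℝ) - 1 / 2 * i| ≤ (n : ℝ) ^ (3 / 5 : ℝ) := by
  have hn1 : (1 : ℝ) < n := by exact_mod_cast hn
  have hi0 : (0 : ℝ) ≤ i := Nat.cast_nonneg i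
  by_cases hfar : (n : ℝ) ^ (3 / 10 : ℝ) < (i : ℝ)
  · have := h.ct_far i 0 hi (Nat.zero_le n)
    simp only [Nat.cast_zero, sub_zero, abs_of_nonneg hi0, ct_zero] at this
    refine (this hfar).le.trans ?_
    have h1 : (i : ℝ) ^ (3 / 5 : ℝ) ≤ (n : ℝ) ^ (3 / 5 : ℝ) :=
      Real.rpow_le_rpow hi0 (by exact_mod_cast hi) (by norm_num)
    have h2 : 0 ≤ (i : ℝ) ^ (3 / 5 : ℝ) := by positivity
    linarith
  · have := h.ct_near i 0 hi (Nat.zero_le n)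
    simp only [Nat.cast_zero, sub_zero, abs_of_nonneg hi0, ct_zero] at this
    refine (this ((not_lt.1 hfar).trans_lt ?_)).le.trans ?_
    · exact Real.rpow_lt_rpow_of_exponent_lt hn1 (by norm_num)
    · exact Real.rpow_le_rpow_of_exponent_le hn1.le (by norm_num)

/-- Replacing every count by half its index costs at most three errors `n ^ 0.6` in each condition,
that is `6 * n ^ 0.6` after doubling, while the distance of the anchor from the ends leaves a margin
`n ^ 0.9`. -/
theorem isRectangular_of_mem_Omega :
    ∀ᶠ n : ℕ in atTop, ∀ ω ∈ Omega n, ω.IsRectangular := by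
  filter_upwards [eventually_mul_rpow_le 10 (by norm_num : (3 / 5 : ℝ) < 9 / 10),
    eventually_ge_atTop 2] with n he hn ω hω
  obtain ⟨hgood, hP, hz1, hz2⟩ := hω
  have hn1 : (1 : ℝ) ≤ n := by exact_mod_cast (by omega : 1 ≤ n)
  have he1 : 1 ≤ (n : ℝ) ^ (3 / 5 : ℝ) := Real.one_le_rpow hn1 (by norm_num)
  set e : ℝ := (n : ℝ) ^ (3 / 5 : ℝ)
  set N : ℝ := (n : ℝ) ^ (9 / 10 : ℝ)
  have hU := fun i (hi : i ≤ n) => abs_le.1 (hP.U.abs_ct_sub_half_le hn hi)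
  have hD := fun i (hi : i ≤ n) => abs_le.1 (hP.D.abs_ct_sub_half_le hn hi)
  have hL := fun i (hi : i ≤ n) => abs_le.1 (hP.L.abs_ct_sub_half_le hn hi)
  have hR := fun i (hi : i ≤ n) => abs_le.1 (hP.R.abs_ct_sub_half_le hn hi)
  have hc : -e ≤ (ω.anchorRank : ℝ) - 1 / 2 * ω.z₀ ∧ (ω.anchorRank : ℝ) - 1 / 2 * ω.z₀ ≤ e :=
    hD ω.z₀ ω.anchor.2
  have hUn := hU n le_rfl
  have hDn := hD n le_rfl
  have hLn := hL n le_rfl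
  refine ⟨hgood, ?_, ?_, ?_, fun k l _ _ h => ?_, fun k l _ _ h => ?_, fun k l _ _ h => ?_,
    fun k l _ _ h => ?_⟩
  · have : (ω.anchorRank : ℝ) < ct ω.Y LR.L n := by linarith
    exact_mod_cast this
  · have : (ω.anchorRank : ℝ) < ct ω.X UD.D n := by linarith
    exact_mod_cast this
  · have : (ct ω.Y LR.L n : ℝ) ≤ ω.anchorRank + ct ω.X UD.U n := by linarith
    exact_mod_cast this
  · have h1 := hD (k + 1) k.2
    have h2 := hL (l + 1) l.2
    have h3 : (ct ω.X UD.D (k + 1) : ℝ) + ct ω.Y LR.L (l + 1) = ω.anchorRank + 1 := by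
      exact_mod_cast h
    push_cast at h1 h2
    have : (k : ℝ) + l < n := by linarith
    exact_mod_cast this
  · have h1 := hU (k + 1) k.2
    have h2 := hL (l + 1) l.2
    have h3 : (ct ω.Y LR.L (l + 1) : ℝ) = ω.anchorRank + ct ω.X UD.U (k + 1) := by
      exact_mod_cast h
    push_cast at h1 h2
    have : (k : ℝ) < l := by linarith
    exact_mod_cast this
  · have h1 := hD (k + 1) k.2
    have h2 := hR (l + 1) l.2
    have h3 : (ct ω.X UD.D (k + 1) : ℝ) = ω.anchorRank + ct ω.Y LR.R (l + 1) := by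
      exact_mod_cast h
    push_cast at h1 h2
    have : (l : ℝ) < k := by linarith
    exact_mod_cast this
  · have h1 := hU (k + 1) k.2
    have h2 := hR (l + 1) l.2
    have h3 : (ct ω.X UD.U (k + 1) : ℝ) + ct ω.Y LR.R (l + 1) + ω.anchorRank = n + 1 := by
      exact_mod_cast h
    push_cast at h1 h2
    have : (n : ℝ) ≤ k + l := by linarith
    exact_mod_cast this

end Regular

/-! ### Most good anchored pairs are regular. -/

section Counting

variable {n : ℕ}

namespace Anchored

theorem ncard_le_of_forall_mem (A : Finset (Fin n → UD)) (B : Finset (Fin n → LR))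
    (C : Finset (Fin n)) (S : Set (Anchored n))
    (h : ∀ ω ∈ S, ω.X ∈ A ∧ ω.Y ∈ B ∧ ω.anchor ∈ C) :
    S.ncard ≤ A.card * (B.card * C.card) := by
  rw [← Finset.card_product, ← Finset.card_product, ← Set.ncard_coe_finset]
  refine Set.ncard_le_ncard_of_injOn equivProd (fun ω hω => ?_) equivProd.injective.injOn
    (Set.toFinite _)
  simpa [equivProd] using h ω hω

theorem card_eq : Nat.card (Anchored n) = n * 4 ^ n := by
  rw [Nat.card_congr equivProd, Nat.card_prod, Nat.card_prod, Nat.card_eq_fintype_card,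
    Nat.card_eq_fintype_card, Nat.card_eq_fintype_card, Fintype.card_fun, Fintype.card_fun,
    card_UD, card_LR, Fintype.card_fin, ← mul_assoc, ← mul_pow, mul_comm]
  norm_num

/-- Change the labels of an anchored pair so that it becomes good. -/
def makeGood (ω : Anchored n) : Anchored n where
  X k := if (k : ℕ) + 1 = 1 ∨ (k : ℕ) + 1 = n ∨ k = ω.anchor then UD.D else ω.X k
  Y k := if (k : ℕ) + 1 = 1 ∨ (k : ℕ) + 1 = n then LR.L else ω.Y k
  anchor := ω.anchor

theorem makeGood_isGood (ω : Anchored n) : ω.makeGood.IsGood where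
  X_first _ hk := if_pos (Or.inl hk)
  X_last _ hk := if_pos (Or.inr (Or.inl hk))
  X_anchor := if_pos (Or.inr (Or.inr rfl))
  Y_first _ hk := if_pos (Or.inl hk)
  Y_last _ hk := if_pos (Or.inr hk)

theorem card_le_good : n * 4 ^ n ≤ {ω : Anchored n | ω.IsGood}.ncard * 32 := by
  rcases Nat.eq_zero_or_pos n with rfl | hn
  · simp
  let first : Fin n := ⟨0, hn⟩
  let last : Fin n := ⟨n - 1, by omega⟩
  -- At most five labels are overwritten by `makeGood`; keeping their old values makes the map
  -- injective, at the cost of a factor `2 ^ 5 = 32`.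
  let f : Anchored n → {ω : Anchored n // ω.IsGood} × (UD × UD × UD) × (LR × LR) := fun ω =>
    (⟨ω.makeGood, ω.makeGood_isGood⟩, (ω.X first, ω.X last, ω.X ω.anchor),
      (ω.Y first, ω.Y last))
  have hf : Function.Injective f := by
    intro ω ω' h
    simp only [f, Prod.mk.injEq, Subtype.mk.injEq, makeGood, Anchored.mk.injEq] at h
    obtain ⟨⟨hX, hY, ha⟩, ⟨h1, h2, h3⟩, h4, h5⟩ := h
    have e1 : ∀ k : Fin n, (k : ℕ) + 1 = 1 → k = first := fun k hk => Fin.ext (by simpa using hk)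
    have e2 : ∀ k : Fin n, (k : ℕ) + 1 = n → k = last := fun k hk => Fin.ext (by
      simp only [last]
      omega)
    have hX' : ω.X = ω'.X := by
      funext k
      have := congrFun hX k
      by_cases k1 : (k : ℕ) + 1 = 1
      · rw [e1 k k1, h1]
      by_cases k2 : (k : ℕ) + 1 = n
      · rw [e2 k k2, h2]
      by_cases k3 : k = ω.anchor
      · rw [k3, h3, ha]
      · rwa [if_neg (by tauto), if_neg (by rw [← ha]; tauto)] at this
    have hY' : ω.Y = ω'.Y := by
      funext k
      have := congrFun hY k
      by_cases k1 : (k : ℕ) + 1 = 1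
      · rw [e1 k k1, h4]
      by_cases k2 : (k : ℕ) + 1 = n
      · rw [e2 k k2, h5]
      · rwa [if_neg (by tauto), if_neg (by tauto)] at this
    cases ω
    cases ω'
    simp_all
  have := Nat.card_le_card_of_injective f hf
  rw [card_eq, Nat.card_prod, Nat.card_prod, Nat.card_prod, Nat.card_prod, Nat.card_prod,
    Nat.card_eq_fintype_card (α := UD), Nat.card_eq_fintype_card (α := LR), card_UD, card_LR]
    at this
  exact this

end Anchored

theorem card_small_anchor_le (N : ℝ) (hN : 0 ≤ N) :
    ((Finset.univ.filter fun k : Fin n => ((k : ℕ) + 1 : ℝ) < N).card : ℝ) ≤ N := by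
  have : (Finset.univ.filter fun k : Fin n => ((k : ℕ) + 1 : ℝ) < N).card ≤ ⌊N⌋₊ := by
    rw [← Finset.card_range ⌊N⌋₊, ← Finset.card_map Fin.valEmbedding]
    refine Finset.card_le_card fun k hk => ?_
    obtain ⟨l, hl, rfl⟩ := Finset.mem_map.1 hk
    rw [Finset.mem_range, Fin.valEmbedding_apply]
    refine Nat.lt_of_succ_le (Nat.le_floor ?_)
    push_cast
    exact (Finset.mem_filter.1 hl).2.le
  exact (Nat.cast_le.2 this).trans (Nat.floor_le hN)

theorem card_large_anchor_le (N : ℝ) (hN : 0 ≤ N) :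
    ((Finset.univ.filter fun k : Fin n => (n : ℝ) - N < ((k : ℕ) + 1 : ℝ)).card : ℝ) ≤ N + 1 := by
  have h1 : (Finset.univ.filter fun k : Fin n => (n : ℝ) - N < ((k : ℕ) + 1 : ℝ)).card
      ≤ (Finset.univ.filter fun k : Fin n => ((k : ℕ) + 1 : ℝ) < N + 1).card := by
    refine Finset.card_le_card_of_injOn Fin.rev (fun k hk => ?_) Fin.rev_injective.injOn
    simp only [Finset.coe_filter, Finset.mem_univ, true_and, Set.mem_ofPred_eq, Fin.val_rev]
      at hk ⊢
    rw [Nat.cast_sub k.2]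
    push_cast
    linarith
  exact (Nat.cast_le.2 h1).trans (card_small_anchor_le (N + 1) (by linarith))

/-- A bound for the proportion of anchored pairs that are not regular. -/
noncomputable def defect (n : ℕ) : ℝ :=
  (2 * (n : ℝ) ^ (9 / 10 : ℝ) + 1) / n
    -- Four labels, each with the factor 2 of the two-sided tail bound.
    + 8 * ((n + 1 : ℝ) ^ 2 * Real.exp (-2 * (n : ℝ) ^ (1 / 20 : ℝ)))

open Classical in
theorem ncard_good_diff_Omega_le : ∀ᶠ n : ℕ in atTop,
    (({ω : Anchored n | ω.IsGood} \ Omega n).ncard : ℝ) ≤ defect n * (n * 4 ^ n) := by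
  filter_upwards [petrovLabel_of_hasSmallDeviations, eventually_gt_atTop 0] with n hP hn0
  have hn : (0 : ℝ) < n := Nat.cast_pos.2 hn0
  set q : ℝ := (n : ℝ) ^ (1 / 20 : ℝ)
  have hq : 0 ≤ q := by positivity
  set N : ℝ := (n : ℝ) ^ (9 / 10 : ℝ)
  have hN : 0 ≤ N := by positivity
  let C₁ : Finset (Fin n) := Finset.univ.filter fun k => ((k : ℕ) + 1 : ℝ) < N
  let C₂ : Finset (Fin n) := Finset.univ.filter fun k => (n : ℝ) - N < ((k : ℕ) + 1 : ℝ)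
  let A : UD → Finset (Fin n → UD) := fun a =>
    Finset.univ.filter fun s => ¬ HasSmallDeviations s a q
  let B : LR → Finset (Fin n → LR) := fun a =>
    Finset.univ.filter fun s => ¬ HasSmallDeviations s a q
  let S₁ : Set (Anchored n) := {ω | ω.anchor ∈ C₁}
  let S₂ : Set (Anchored n) := {ω | ω.anchor ∈ C₂}
  let SX : UD → Set (Anchored n) := fun a => {ω | ω.X ∈ A a}
  let SY : LR → Set (Anchored n) := fun a => {ω | ω.Y ∈ B a}
  have hsub : {ω : Anchored n | ω.IsGood} \ Omega n ⊆
      S₁ ∪ S₂ ∪ (SX UD.U ∪ SX UD.D) ∪ (SY LR.L ∪ SY LR.R) := by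
    rintro ω ⟨hg, hω⟩
    by_contra hcon
    simp only [S₁, S₂, SX, SY, A, B, C₁, C₂, Set.mem_union, Set.mem_ofPred_eq,
      Finset.mem_filter, Finset.mem_univ, true_and, not_or, not_not, not_lt] at hcon
    obtain ⟨⟨⟨h1, h2⟩, hU, hD⟩, hL, hR⟩ := hcon
    refine hω ⟨hg, ⟨hP _ _ hU, hP _ _ hD, hP _ _ hL, hP _ _ hR⟩, ?_, ?_⟩
    · simpa [Anchored.z₀] using h1
    · simpa [Anchored.z₀] using h2
  have h2n : (Finset.univ : Finset (Fin n → UD)).card = 2 ^ n := by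
    rw [Finset.card_univ, Fintype.card_fun, card_UD, Fintype.card_fin]
  have h2n' : (Finset.univ : Finset (Fin n → LR)).card = 2 ^ n := by
    rw [Finset.card_univ, Fintype.card_fun, card_LR, Fintype.card_fin]
  have h44 : (2 : ℝ) ^ n * 2 ^ n = 4 ^ n := by
    rw [← mul_pow]
    norm_num
  have hS₁ : (S₁.ncard : ℝ) ≤ 4 ^ n * N := by
    have h1 := Anchored.ncard_le_of_forall_mem Finset.univ Finset.univ C₁ S₁
      fun ω hω => ⟨Finset.mem_univ _, Finset.mem_univ _, hω⟩
    rw [h2n, h2n', ← mul_assoc] at h1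
    have h2 : (S₁.ncard : ℝ) ≤ 2 ^ n * 2 ^ n * C₁.card := by exact_mod_cast h1
    rw [h44] at h2
    exact h2.trans (mul_le_mul_of_nonneg_left (card_small_anchor_le N hN) (by positivity))
  have hS₂ : (S₂.ncard : ℝ) ≤ 4 ^ n * (N + 1) := by
    have h1 := Anchored.ncard_le_of_forall_mem Finset.univ Finset.univ C₂ S₂
      fun ω hω => ⟨Finset.mem_univ _, Finset.mem_univ _, hω⟩
    rw [h2n, h2n', ← mul_assoc] at h1
    have h2 : (S₂.ncard : ℝ) ≤ 2 ^ n * 2 ^ n * C₂.card := by exact_mod_cast h1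
    rw [h44] at h2
    exact h2.trans (mul_le_mul_of_nonneg_left (card_large_anchor_le N hN) (by positivity))
  have hSX : ∀ a, ((SX a).ncard : ℝ) ≤ 4 ^ n * n * (2 * ((n + 1 : ℝ) ^ 2 * Real.exp (-2 * q))) := by
    intro a
    have h1 := Anchored.ncard_le_of_forall_mem (A a) Finset.univ Finset.univ (SX a)
      fun ω hω => ⟨hω, Finset.mem_univ _, Finset.mem_univ _⟩
    rw [h2n', Finset.card_univ, Fintype.card_fin] at h1
    have h2 : ((SX a).ncard : ℝ) ≤ (A a).card * (2 ^ n * n) := by exact_mod_cast h1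
    refine h2.trans ((mul_le_mul_of_nonneg_right
      (card_not_hasSmallDeviations_le card_UD a hq) (by positivity)).trans_eq ?_)
    rw [← h44]
    ring
  have hSY : ∀ a, ((SY a).ncard : ℝ) ≤ 4 ^ n * n * (2 * ((n + 1 : ℝ) ^ 2 * Real.exp (-2 * q))) := by
    intro a
    have h1 := Anchored.ncard_le_of_forall_mem Finset.univ (B a) Finset.univ (SY a)
      fun ω hω => ⟨Finset.mem_univ _, hω, Finset.mem_univ _⟩
    rw [h2n, Finset.card_univ, Fintype.card_fin] at h1
    have h2 : ((SY a).ncard : ℝ) ≤ 2 ^ n * ((B a).card * n) := by exact_mod_cast h1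
    refine h2.trans ((mul_le_mul_of_nonneg_left (mul_le_mul_of_nonneg_right
      (card_not_hasSmallDeviations_le card_LR a hq) hn.le) (by positivity)).trans_eq ?_)
    rw [← h44]
    ring
  have hcard : ({ω : Anchored n | ω.IsGood} \ Omega n).ncard ≤
      S₁.ncard + S₂.ncard + ((SX UD.U).ncard + (SX UD.D).ncard)
        + ((SY LR.L).ncard + (SY LR.R).ncard) := by
    refine (Set.ncard_le_ncard hsub (Set.toFinite _)).trans ?_
    have e1 := Set.ncard_union_le S₁ S₂
    have e2 := Set.ncard_union_le (SX UD.U) (SX UD.D)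
    have e3 := Set.ncard_union_le (SY LR.L) (SY LR.R)
    have e4 := Set.ncard_union_le (S₁ ∪ S₂) (SX UD.U ∪ SX UD.D)
    have e5 := Set.ncard_union_le (S₁ ∪ S₂ ∪ (SX UD.U ∪ SX UD.D)) (SY LR.L ∪ SY LR.R)
    omega
  have hcard' : (({ω : Anchored n | ω.IsGood} \ Omega n).ncard : ℝ) ≤
      S₁.ncard + S₂.ncard + ((SX UD.U).ncard + (SX UD.D).ncard)
        + ((SY LR.L).ncard + (SY LR.R).ncard) := by exact_mod_cast hcard
  have hdef : defect n * (n * 4 ^ n) = 4 ^ n * N + 4 ^ n * (N + 1)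
      + 4 * (4 ^ n * n * (2 * ((n + 1 : ℝ) ^ 2 * Real.exp (-2 * q)))) := by
    unfold defect
    field_simp
    ring
  rw [hdef]
  have := hSX UD.U
  have := hSX UD.D
  have := hSY LR.L
  have := hSY LR.R
  linarith

/-- The polynomial factor is harmless: `n ^ 2` is the 40th power of `n ^ (1 / 20)`, which the
exponential beats. -/
theorem tendsto_defect : Tendsto defect atTop (𝓝 0) := by
  have hcast := tendsto_natCast_atTop_atTop (R := ℝ)
  have h1 : Tendsto (fun n : ℕ => (n : ℝ) ^ (-(1 / 10 : ℝ))) atTop (𝓝 0) :=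
    (tendsto_rpow_neg_atTop (by norm_num)).comp hcast
  have h2 : Tendsto (fun n : ℕ => ((n : ℝ))⁻¹) atTop (𝓝 0) := tendsto_inv_atTop_zero.comp hcast
  have h3 : Tendsto (fun n : ℕ => ((n : ℝ) ^ (1 / 20 : ℝ)) ^ 40 *
      Real.exp (-((n : ℝ) ^ (1 / 20 : ℝ)))) atTop (𝓝 0) :=
    (Real.tendsto_pow_mul_exp_neg_atTop_nhds_zero 40).comp
      ((tendsto_rpow_atTop (by norm_num)).comp hcast)
  have h4 : Tendsto (fun n : ℕ => 2 * (n : ℝ) ^ (-(1 / 10 : ℝ)) + ((n : ℝ))⁻¹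
      + 32 * (((n : ℝ) ^ (1 / 20 : ℝ)) ^ 40 * Real.exp (-((n : ℝ) ^ (1 / 20 : ℝ)))))
      atTop (𝓝 0) := by
    simpa using ((h1.const_mul 2).add h2).add (h3.const_mul 32)
  refine squeeze_zero' (Eventually.of_forall fun n => ?_) ?_ h4
  · unfold defect
    positivity
  · filter_upwards [eventually_ge_atTop 1] with n hn
    have hn1 : (1 : ℝ) ≤ n := by exact_mod_cast hn
    have hn0 : (0 : ℝ) < n := by linarith
    have e1 : (n : ℝ) ^ (9 / 10 : ℝ) / n = (n : ℝ) ^ (-(1 / 10 : ℝ)) := by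
      rw [← Real.rpow_sub_one hn0.ne']
      norm_num
    have e2 : ((n : ℝ) ^ (1 / 20 : ℝ)) ^ 40 = (n : ℝ) ^ 2 := by
      rw [← Real.rpow_natCast, ← Real.rpow_mul hn0.le, ← Real.rpow_natCast]
      norm_num
    have e3 : Real.exp (-2 * (n : ℝ) ^ (1 / 20 : ℝ)) ≤ Real.exp (-((n : ℝ) ^ (1 / 20 : ℝ))) := by
      have : 0 ≤ (n : ℝ) ^ (1 / 20 : ℝ) := by positivity
      exact Real.exp_le_exp.2 (by linarith)
    have e4 : (n + 1 : ℝ) ^ 2 ≤ 4 * (n : ℝ) ^ 2 := by nlinarith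
    have e5 : (n + 1 : ℝ) ^ 2 * Real.exp (-2 * (n : ℝ) ^ (1 / 20 : ℝ))
        ≤ 4 * (n : ℝ) ^ 2 * Real.exp (-((n : ℝ) ^ (1 / 20 : ℝ))) :=
      mul_le_mul e4 e3 (Real.exp_pos _).le (by positivity)
    rw [defect, add_div, mul_div_assoc, e1, e2, one_div (n : ℝ)]
    linarith

end Counting

/-! ### The proportion of square permutations coming from regular pairs. -/

theorem ncard_rho_image_le (n : ℕ) (h : Set.MapsTo rho (Omega n) (Sq n : Set _)) :
    (rho '' Omega n).ncard ≤ (Sq n).card := by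
  rw [← Set.ncard_coe_finset]
  exact Set.ncard_le_ncard h.image_subset (Set.toFinite _)

/-- Almost all square permutations come from regular anchored pairs. -/
theorem one_sub_le_ncard_rho_image_div : ∀ᶠ n : ℕ in atTop,
    1 - 64 * (defect n + 1 / n) ≤ ((rho '' Omega n).ncard : ℝ) / (Sq n).card := by
  have hlim : Tendsto (fun n : ℕ => defect n) atTop (𝓝 0) := tendsto_defect
  filter_upwards [isRectangular_of_mem_Omega, ncard_good_diff_Omega_le, eventually_gt_atTop 0,
    hlim.eventually_le_const (by norm_num : (0 : ℝ) < 1 / 64)] with n hrect hbad hn0 hsmall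
  have : NeZero n := ⟨hn0.ne'⟩
  have hn : (0 : ℝ) < n := Nat.cast_pos.2 hn0
  have hmaps : Set.MapsTo rho (Omega n) (Sq n : Set _) := fun ω hω => (hrect ω hω).rho_mem_Sq
  have hinj : Set.InjOn rho (Omega n) := Anchored.IsRectangular.rho_injOn.mono hrect
  have h1 : (rho '' Omega n).ncard = (Omega n).ncard := hinj.ncard_image
  have h2 := ncard_rho_image_le n hmaps
  have h3 := card_Sq_le n
  have h4 := Anchored.card_le_good (n := n)
  have h5 : {ω : Anchored n | ω.IsGood}.ncard
      = ({ω : Anchored n | ω.IsGood} \ Omega n).ncard + (Omega n).ncard :=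
    (Set.ncard_sdiff_add_ncard_of_subset (fun ω hω => hω.1) (Set.toFinite _)).symm
  rw [h1] at h2 ⊢
  have h2' : ((Omega n).ncard : ℝ) ≤ (Sq n).card := by exact_mod_cast h2
  have h3' : ((Sq n).card : ℝ) ≤ ({ω : Anchored n | ω.IsGood} \ Omega n).ncard
      + (Omega n).ncard + 4 ^ n := by exact_mod_cast h5 ▸ h3
  have h4' : (n : ℝ) * 4 ^ n ≤ (({ω : Anchored n | ω.IsGood} \ Omega n).ncard
      + (Omega n).ncard) * 32 := by exact_mod_cast h5 ▸ h4
  set T : ℝ := n * 4 ^ n with hT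
  have hT0 : 0 < T := by positivity
  have h6 : defect n * T ≤ 1 / 64 * T := mul_le_mul_of_nonneg_right hsmall hT0.le
  -- From `T ≤ 32 * |good|` and at most `T / 64` good pairs that are not regular, `T / 2 ≤ 32 *
  -- |Ω_n| ≤ 32 * |Sq n|`. This turns errors relative to `n 4 ^ n` into errors relative to `|Sq n|`.
  have h7 : T ≤ 64 * (Sq n).card := by linarith
  have h8 : 0 < ((Sq n).card : ℝ) := by linarith
  have h9 : (4 : ℝ) ^ n = 1 / n * T := by
    rw [hT]
    field_simp
  have h10 : 0 ≤ defect n + 1 / n := by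
    unfold defect
    positivity
  rw [le_div_iff₀ h8]
  have h11 := mul_le_mul_of_nonneg_left h7 h10
  linarith

theorem toOuterMeasure_uniformOfFinset_Sq (n : ℕ) (t : Set (Equiv.Perm (Fin n)))
    (ht : t ⊆ (Sq n : Set _)) :
    (PMF.uniformOfFinset (Sq n) (Sq_nonempty n)).toOuterMeasure t
      = ENNReal.ofReal ((t.ncard : ℝ) / (Sq n).card) := by
  classical
  have h1 : ((Sq n).filter (· ∈ t)).card = t.ncard := by
    rw [← Set.ncard_coe_finset]
    congr 1
    ext σ
    simp only [Finset.coe_filter, Set.mem_ofPred_eq]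
    exact ⟨fun h => h.2, fun h => ⟨ht h, h⟩⟩
  have h2 : (0 : ℝ) < (Sq n).card := Nat.cast_pos.2 (Finset.card_pos.2 (Sq_nonempty n))
  rw [PMF.toOuterMeasure_uniformOfFinset_apply, h1, ENNReal.ofReal_div_of_pos h2,
    ENNReal.ofReal_natCast, ENNReal.ofReal_natCast]

theorem tendsto_ncard_rho_image_div :
    Tendsto (fun n : ℕ => ((rho '' Omega n).ncard : ℝ) / (Sq n).card) atTop (𝓝 1) := by
  have h1 : Tendsto (fun n : ℕ => 1 - 64 * (defect n + 1 / (n : ℝ))) atTop (𝓝 1) := by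
    simpa using ((tendsto_defect.add tendsto_one_div_atTop_nhds_zero_nat).const_mul 64).const_sub 1
  refine tendsto_of_tendsto_of_tendsto_of_le_of_le' h1 tendsto_const_nhds
    one_sub_le_ncard_rho_image_div ?_
  filter_upwards [isRectangular_of_mem_Omega] with n hrect
  refine div_le_one_of_le₀ (Nat.cast_le.2 (ncard_rho_image_le n fun ω hω => ?_))
    (Nat.cast_nonneg _)
  exact (hrect ω hω).rho_mem_Sq

end SquarePerm

theorem lemma3p6 :
    (∀ᶠ n : ℕ in atTop,
      (∀ ω ∈ SquarePerm.Omega n, SquarePerm.diagram (SquarePerm.rho ω) = ω.points) ∧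
      Set.MapsTo SquarePerm.rho (SquarePerm.Omega n) (SquarePerm.Sq n) ∧
      Set.InjOn SquarePerm.rho (SquarePerm.Omega n)) ∧
    Tendsto
      (fun n : ℕ =>
        (PMF.uniformOfFinset (SquarePerm.Sq n) (SquarePerm.Sq_nonempty n)).toOuterMeasure
          (SquarePerm.rho '' SquarePerm.Omega n))
      atTop (𝓝 1) := by
  refine ⟨?_, ?_⟩
  · filter_upwards [SquarePerm.isRectangular_of_mem_Omega] with n hrect
    exact ⟨fun ω hω => SquarePerm.Anchored.diagram_rho (hrect ω hω).isBalanced,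
      fun ω hω => (hrect ω hω).rho_mem_Sq,
      SquarePerm.Anchored.IsRectangular.rho_injOn.mono hrect⟩
  · have h := ENNReal.tendsto_ofReal SquarePerm.tendsto_ncard_rho_image_div
    rw [ENNReal.ofReal_one] at h
    refine h.congr' ?_
    filter_upwards [SquarePerm.isRectangular_of_mem_Omega] with n hrect
    refine (SquarePerm.toOuterMeasure_uniformOfFinset_Sq n _ ?_).symm
    rintro _ ⟨ω, hω, rfl⟩
    exact (hrect ω hω).rho_mem_Sq
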